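/- Let $\overline{M}_{0,n}$ be the moduli space of stable $n$-pointed rational curves over $\mathbb{C}$, that is, of isomorphism classes of tuples $(C,p_1,\dots,p_n)$ where $C$ is a connected nodal curve of arithmetic genus $0$, the $p_i$ are distinct smooth points of $C$, and every component of $C$ has at least three special points (nodes or marked points). Let $\phi=(\psi_4\circ\pi_5,\ \psi_5):\overline{M}_{0,5}\to\mathbb{P}^1_{[a_0:a_1]}\times\mathbb{P}^2_{[b_0:b_1:b_2]}$, where $\pi_5$ forgets $p_5$ and stabilizes, and $\psi_n:\overline{M}_{0,n}\to\mathbb{P}^{n-3}$ is the Kapranov map, whose coordinates, for $2\le j\le n-1$, are the values at $p_n$ of the logarithmic one-forms on $C$ with poles at $p_1$ and $p_j$ only, with opposite residues $\pm1$ independent of $j$. Thus on the interior, for distinct points $p_1,\dots,p_5\in\mathbb{C}\subset\mathbb{P}^1$, $$\phi[\mathbb{P}^1,p_1,\dots,p_5]=\left(\left[\tfrac{p_1-p_2}{p_4-p_2}:\tfrac{p_1-p_3}{p_4-p_3}\right],\left[\tfrac{p_1-p_2}{p_5-p_2}:\tfrac{p_1-p_3}{p_5-p_3}:\tfrac{p_1-p_4}{p_5-p_4}\right]\right).$$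 (1) The bihomogeneous ideal of $\phi(\overline{M}_{0,5})$ in $\mathbb{C}[a_0,a_1,b_0,b_1,b_2]$, that is, the ideal generated by all bihomogeneous polynomials that vanish on $\phi(\overline{M}_{0,5})$, is the principal ideal generated by $$a_0b_1(b_0-b_2)-a_1b_0(b_1-b_2).$$ (2) $\overline{M}_{0,5}$ is the pencil of conics through the four points $[1:0:0]$, $[0:1:0]$, $[0:0:1]$, $[1:1:1]$ of $\mathbb{P}^2$. That is, put $q_a(b)=a_0b_1(b_0-b_2)-a_1b_0(b_1-b_2)$ for $a\in\mathbb{C}^2$. Then $a\mapsto q_a$ is a bijection from $\mathbb{C}^2$ onto the space of quadratic forms in $b_0,b_1,b_2$ that vanish at these four points, and $\phi$ is a bijection from $\overline{M}_{0,5}$ onto the set of all $([a],[b])\in\mathbb{P}^1\times\mathbb{P}^2$ with $q_a(b)=0$. -/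

import Mathlib

open scoped LinearAlgebra.Projectivization

noncomputable section

namespace PointedCurves

/-- The complex projective line, in homogeneous coordinates. -/
abbrev P1 : Type := ℙ ℂ (Fin 2 → ℂ)

/-- Linear automorphisms of `ℂ²`; they act on `P1` through `PGL(2, ℂ)`. -/
abbrev Aut2 : Type := (Fin 2 → ℂ) ≃ₗ[ℂ] (Fin 2 → ℂ)

/-- The homogeneous form of the difference of two points of `P1`, computed on chosen homogeneous
coordinates: on the coordinates `(p, 1)` and `(q, 1)` it is `p - q`. Only ratios which do not
depend on the choice of coordinates are used below. -/
def bracket (x y : P1) : ℂ := x.rep 0 * y.rep 1 - x.rep 1 * y.rep 0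

lemma bracket_eq_zero_iff (x y : P1) : bracket x y = 0 ↔ x = y := by
  constructor
  · intro h
    rw [← x.mk_rep, ← y.mk_rep, Projectivization.mk_eq_mk_iff']
    unfold bracket at h
    by_cases h0 : y.rep 0 = 0
    · have h1 : y.rep 1 ≠ 0 := fun h1 => y.rep_nonzero (by ext i; fin_cases i <;> assumption)
      refine ⟨x.rep 1 / y.rep 1, ?_⟩
      have h2 : x.rep 0 = 0 := by
        rw [h0, mul_zero, sub_zero] at h
        exact (mul_eq_zero.1 h).resolve_right h1
      ext i
      fin_cases i
      · simp [h0, h2]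
      · simp [h1]
    · refine ⟨x.rep 0 / y.rep 0, ?_⟩
      ext i
      fin_cases i
      · simp [h0]
      · simp only [Fin.mk_one, Pi.smul_apply, smul_eq_mul]
        rw [div_mul_eq_mul_div, div_eq_iff h0]
        linear_combination h
  · rintro rfl
    unfold bracket
    ring

lemma rep_smul (g : Aut2) (x : P1) : ∃ c : ℂ, c ≠ 0 ∧ (g • x).rep = c • g x.rep := by
  have h : g • x = Projectivization.mk ℂ (g x.rep) (by simpa using x.rep_nonzero) := by
    conv_lhs => rw [← x.mk_rep, Projectivization.smul_mk]
    rfl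
  obtain ⟨c, hc⟩ := Projectivization.exists_smul_eq_mk_rep ℂ (g x.rep)
    (by simpa using x.rep_nonzero)
  exact ⟨c, c.ne_zero, by rw [h, ← hc]; rfl⟩

lemma bracket_smul (g : Aut2) :
    ∃ (d : ℂ) (c : P1 → ℂ), d ≠ 0 ∧ (∀ x, c x ≠ 0) ∧
      ∀ x y, bracket (g • x) (g • y) = d * c x * c y * bracket x y := by
  choose c hc0 hc using rep_smul g
  refine ⟨LinearMap.det (g : (Fin 2 → ℂ) →ₗ[ℂ] (Fin 2 → ℂ)), c, (LinearEquiv.isUnit_det' g).ne_zero,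
    hc0, fun x y => ?_⟩
  rw [← LinearMap.det_toMatrix']
  have hg : ∀ v i, g v i = ((g : (Fin 2 → ℂ) →ₗ[ℂ] (Fin 2 → ℂ)).toMatrix'.mulVec v) i := by
    intro v i
    rw [LinearMap.toMatrix'_mulVec]; rfl
  unfold bracket
  rw [hc, hc, Matrix.det_fin_two]
  simp only [Pi.smul_apply, smul_eq_mul, hg, Matrix.mulVec, dotProduct, Fin.sum_univ_two]
  ring

/-- A stable `n`-pointed rational curve over `ℂ`: a connected nodal curve of arithmetic genus `0`
with `n` distinct marked smooth points, each of whose components has at least three special points.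
Such a curve is a tree of projective lines: `V` is the set of irreducible components, each of them
a copy of `P1`, and `graph` is the dual graph. If the components `v` and `w` meet, then
`node v w` is the point of `v` which is glued to the point `node w v` of `w`
(`node v w` has no meaning when `v` and `w` do not meet, and is then ignored everywhere below). -/
structure StableCurve (n : ℕ) where
  V : Type
  finite : Finite V
  graph : SimpleGraph V
  isTree : graph.IsTree
  node : V → V → P1
  /-- the component which carries the `i`-th marked point -/
  comp : Fin n → V
  /-- the `i`-th marked point, as a point of its component -/
  mark : Fin n → P1
  node_inj : ∀ v w w', graph.Adj v w → graph.Adj v w' → node v w = node v w' → w = w'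
  mark_inj : ∀ i j, comp i = comp j → mark i = mark j → i = j
  mark_ne_node : ∀ i w, graph.Adj (comp i) w → mark i ≠ node (comp i) w
  stable : ∀ v, 3 ≤ {w | graph.Adj v w}.ncard + {i | comp i = v}.ncard

namespace StableCurve

attribute [instance] StableCurve.finite

variable {n : ℕ}

/-- The number of special points (nodes and marked points) on a component. -/
def special (C : StableCurve n) (v : C.V) : ℕ :=
  {w | C.graph.Adj v w}.ncard + {i | C.comp i = v}.ncard

/-- An isomorphism of stable pointed curves: an isomorphism of dual graphs together with projective
transformations of the components, compatible with the nodes and with the marked points. -/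
structure Iso (C D : StableCurve n) where
  toEquiv : C.V ≃ D.V
  adj_iff : ∀ v w, D.graph.Adj (toEquiv v) (toEquiv w) ↔ C.graph.Adj v w
  aut : C.V → Aut2
  node_eq : ∀ v w, C.graph.Adj v w → D.node (toEquiv v) (toEquiv w) = aut v • C.node v w
  comp_eq : ∀ i, D.comp i = toEquiv (C.comp i)
  mark_eq : ∀ i, D.mark i = aut (C.comp i) • C.mark i

def Iso.refl (C : StableCurve n) : Iso C C where
  toEquiv := Equiv.refl _
  adj_iff _ _ := Iff.rfl
  aut _ := 1
  node_eq _ _ _ := by simp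
  comp_eq _ := rfl
  mark_eq _ := by simp

def Iso.symm {C D : StableCurve n} (e : Iso C D) : Iso D C where
  toEquiv := e.toEquiv.symm
  adj_iff v w := by rw [← e.adj_iff]; simp
  aut v := (e.aut (e.toEquiv.symm v))⁻¹
  node_eq v w h := by
    rw [eq_inv_smul_iff, ← e.node_eq _ _ (by rw [← e.adj_iff]; simpa using h)]; simp
  comp_eq i := by rw [e.comp_eq]; simp
  mark_eq i := by rw [eq_inv_smul_iff, e.mark_eq, e.comp_eq]; simp

def Iso.trans {C D E : StableCurve n} (e : Iso C D) (f : Iso D E) : Iso C E where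
  toEquiv := e.toEquiv.trans f.toEquiv
  adj_iff v w := by simp [f.adj_iff, e.adj_iff]
  aut v := f.aut (e.toEquiv v) * e.aut v
  node_eq v w h := by
    simp only [Equiv.trans_apply]
    rw [f.node_eq _ _ ((e.adj_iff _ _).2 h), e.node_eq _ _ h, mul_smul]
  comp_eq i := by rw [f.comp_eq, e.comp_eq]; rfl
  mark_eq i := by rw [f.mark_eq, e.mark_eq, e.comp_eq, mul_smul]

instance isoSetoid (n : ℕ) : Setoid (StableCurve n) where
  r C D := Nonempty (Iso C D)
  iseqv := ⟨fun C => ⟨Iso.refl C⟩, fun ⟨e⟩ => ⟨e.symm⟩, fun ⟨e⟩ ⟨f⟩ => ⟨e.trans f⟩⟩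

/-- The second vertex on the path in the dual graph from `v` to `w`: the first component that one
enters when one leaves `v` towards `w` (it is `v` itself when `w = v`). -/
def next (C : StableCurve n) (v w : C.V) : C.V :=
  (C.isTree.existsUnique_path v w).choose.snd

lemma next_eq (C : StableCurve n) {v w : C.V} (p : C.graph.Walk v w) (hp : p.IsPath) :
    C.next v w = p.snd := by
  unfold next
  rw [(C.isTree.existsUnique_path v w).choose_spec.2 p hp]

open Classical in
/-- The point of the component `v` in the direction of the `i`-th marked point: the marked point
itself if it lies on `v`, and otherwise the node of `v` that separates `v` from it. -/
def proj (C : StableCurve n) (v : C.V) (i : Fin n) : P1 :=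
  if C.comp i = v then C.mark i else C.node v (C.next v (C.comp i))


/-! ### Forgetting the last marked point -/

section Forget

/-- The graph obtained from `G` by removing the vertex `v₀` and joining its neighbours. -/
def contractGraph {V : Type} (G : SimpleGraph V) (v₀ : V) : SimpleGraph {v : V // v ≠ v₀} where
  Adj v w := G.Adj v w ∨ (G.Adj v₀ v ∧ G.Adj v₀ w ∧ v ≠ w)
  symm := ⟨fun _ _ h => h.elim (fun h => Or.inl h.symm) fun h => Or.inr ⟨h.2.1, h.1, h.2.2.symm⟩⟩
  loopless := ⟨fun _ h => h.elim (fun h => G.loopless.irrefl _ h) fun h => h.2.2 rfl⟩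

lemma contractGraph_isTree {V : Type} [Finite V] (G : SimpleGraph V) (hG : G.IsTree) (v₀ a : V)
    (ha : G.Adj v₀ a) (h2 : ∀ b c, G.Adj v₀ b → G.Adj v₀ c → b ≠ a → c ≠ a → b = c) :
    (contractGraph G v₀).IsTree := by
  classical
  let c : V → {v : V // v ≠ v₀} := fun v => if h : v = v₀ then ⟨a, ha.ne'⟩ else ⟨v, h⟩
  have hc₀ : c v₀ = ⟨a, ha.ne'⟩ := by simp [c]
  have hc : ∀ v (h : v ≠ v₀), c v = ⟨v, h⟩ := fun v h => by simp [c, h]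
  have hconn : (contractGraph G v₀).Connected := by
    have key : ∀ x y, G.Adj x y → (contractGraph G v₀).Reachable (c x) (c y) := by
      have k0 : ∀ y, G.Adj v₀ y → (contractGraph G v₀).Reachable (c v₀) (c y) := by
        intro y h
        rw [hc₀, hc y h.ne']
        by_cases hya : y = a
        · subst hya; exact SimpleGraph.Reachable.refl _
        · refine SimpleGraph.Adj.reachable (Or.inr ⟨ha, h, ?_⟩)
          intro h'; exact hya (congrArg Subtype.val h').symm
      intro x y h
      by_cases hx : x = v₀
      · subst hx; exact k0 y h
      by_cases hy : y = v₀
      · subst hy; exact (k0 x h.symm).symm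
      rw [hc x hx, hc y hy]
      exact SimpleGraph.Adj.reachable (Or.inl h)
    have key' : ∀ x y, G.Walk x y → (contractGraph G v₀).Reachable (c x) (c y) := by
      intro x y p
      induction p with
      | nil => exact SimpleGraph.Reachable.refl _
      | cons h _ ih => exact (key _ _ h).trans ih
    have : Nonempty {v : V // v ≠ v₀} := ⟨⟨a, ha.ne'⟩⟩
    refine SimpleGraph.Connected.mk fun x y => ?_
    obtain ⟨p⟩ := hG.connected.preconnected x.1 y.1
    have := key' _ _ p
    rwa [hc _ x.2, hc _ y.2] at this
  rw [SimpleGraph.isTree_iff_connected_and_card]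
  refine ⟨hconn, le_antisymm ?_ hconn.card_vert_le_card_edgeSet_add_one⟩
  have hE := (SimpleGraph.isTree_iff_connected_and_card.1 hG).2
  have hV : Nat.card V = Nat.card {v : V // v ≠ v₀} + 1 := by
    have h1 := Set.ncard_add_ncard_compl ({v₀} : Set V)
    rw [Set.ncard_singleton] at h1
    have h3 : Nat.card {v : V // v ≠ v₀} = (({v₀} : Set V)ᶜ).ncard := rfl
    omega
  have hsub : (contractGraph G v₀).edgeSet ⊆ Sym2.map c '' (G.edgeSet \ {s(v₀, a)}) := by
    intro e
    induction e using Sym2.ind with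
    | _ x y =>
    intro h
    rcases h with h | ⟨hx, hy, hxy⟩
    · refine ⟨s(x.1, y.1), ⟨h, ?_⟩, ?_⟩
      · simp [x.2, y.2]
      · simp [hc _ x.2, hc _ y.2]
    · have hxy' : x.1 ≠ y.1 := fun h => hxy (Subtype.ext h)
      by_cases hxa : x.1 = a
      · refine ⟨s(v₀, y.1), ⟨hy, ?_⟩, ?_⟩
        · have : y.1 ≠ a := fun h => hxy' (hxa.trans h.symm)
          simp [y.2, this]
        · rw [Sym2.map_mk, hc₀, hc _ y.2]
          exact congrArg (fun z => s(z, y)) (Subtype.ext hxa.symm)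
      · have hya : y.1 = a := by
          by_contra hya
          exact hxy' (h2 _ _ hx hy hxa hya)
        refine ⟨s(x.1, v₀), ⟨hx.symm, ?_⟩, ?_⟩
        · simp [x.2, hxa]
        · rw [Sym2.map_mk, hc₀, hc _ x.2]
          exact congrArg (fun z => s(x, z)) (Subtype.ext hya.symm)
  have h4 : (contractGraph G v₀).edgeSet.ncard ≤ (G.edgeSet \ {s(v₀, a)}).ncard :=
    (Set.ncard_le_ncard hsub (Set.toFinite _)).trans (Set.ncard_image_le (Set.toFinite _))
  have h5 := Set.ncard_sdiff_singleton_add_one (s := G.edgeSet) (a := s(v₀, a)) ha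
    (Set.toFinite _)
  have h6 : Nat.card G.edgeSet = G.edgeSet.ncard := rfl
  have h7 : Nat.card (contractGraph G v₀).edgeSet = (contractGraph G v₀).edgeSet.ncard := rfl
  omega

lemma ncard_marks_le {m : ℕ} {V : Type} (f : Fin (m + 1) → V) (v : V) :
    {i | f i = v}.ncard ≤ {i : Fin m | f i.castSucc = v}.ncard + 1 := by
  have : {i | f i = v} ⊆ insert (Fin.last m) (Fin.castSucc '' {i : Fin m | f i.castSucc = v}) := by
    intro i hi
    induction i using Fin.lastCases with
    | last => exact Or.inl rfl
    | cast i => exact Or.inr ⟨i, hi, rfl⟩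
  refine (Set.ncard_le_ncard this (Set.toFinite _)).trans ((Set.ncard_insert_le _ _).trans ?_)
  exact Nat.add_le_add_right (Set.ncard_image_le (Set.toFinite _)) 1

lemma ncard_marks_le' {m : ℕ} {V : Type} (f : Fin (m + 1) → V) (v : V) (hv : f (Fin.last m) ≠ v) :
    {i | f i = v}.ncard ≤ {i : Fin m | f i.castSucc = v}.ncard := by
  have : {i | f i = v} ⊆ Fin.castSucc '' {i : Fin m | f i.castSucc = v} := by
    intro i hi
    induction i using Fin.lastCases with
    | last => exact absurd hi hv
    | cast i => exact ⟨i, hi, rfl⟩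
  exact (Set.ncard_le_ncard this (Set.toFinite _)).trans (Set.ncard_image_le (Set.toFinite _))

/-- Drop the last marked point when its component has at least three other special points. -/
def dropMark {m : ℕ} (C : StableCurve (m + 1)) (h : 4 ≤ C.special (C.comp (Fin.last m))) :
    StableCurve m where
  V := C.V
  finite := C.finite
  graph := C.graph
  isTree := C.isTree
  node := C.node
  comp i := C.comp i.castSucc
  mark i := C.mark i.castSucc
  node_inj := C.node_inj
  mark_inj i j h h' := Fin.castSucc_injective _ (C.mark_inj _ _ h h')
  mark_ne_node i w h := C.mark_ne_node _ w h
  stable v := by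
    by_cases hv : C.comp (Fin.last m) = v
    · subst hv
      have := ncard_marks_le C.comp (C.comp (Fin.last m))
      unfold special at h
      omega
    · have := ncard_marks_le' C.comp v hv
      have := C.stable v
      omega

variable {k : ℕ}

lemma exists_adj_last (C : StableCurve (k + 4))
    (h : ¬ 4 ≤ C.special (C.comp (Fin.last (k + 3)))) :
    ∃ w, C.graph.Adj (C.comp (Fin.last (k + 3))) w := by
  by_contra hno
  push Not at hno
  apply h
  have hall : ∀ v, v = C.comp (Fin.last (k + 3)) := by
    intro v
    obtain ⟨p⟩ := C.isTree.connected.preconnected (C.comp (Fin.last (k + 3))) v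
    cases p with
    | nil => rfl
    | cons h _ => exact absurd h (hno _)
  have : {i | C.comp i = C.comp (Fin.last (k + 3))} = Set.univ :=
    Set.eq_univ_of_forall fun i => hall _
  unfold special
  rw [this, Set.ncard_univ, Nat.card_eq_fintype_card, Fintype.card_fin]
  omega

lemma last_adj_unique (C : StableCurve (k + 4))
    (h : ¬ 4 ≤ C.special (C.comp (Fin.last (k + 3)))) (a b c : C.V)
    (ha : C.graph.Adj (C.comp (Fin.last (k + 3))) a)
    (hb : C.graph.Adj (C.comp (Fin.last (k + 3))) b)
    (hc : C.graph.Adj (C.comp (Fin.last (k + 3))) c) (hba : b ≠ a) (hca : c ≠ a) : b = c := by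
  classical
  by_contra hbc
  apply h
  have h1 : ({a, b, c} : Set C.V).ncard ≤ {w | C.graph.Adj (C.comp (Fin.last (k + 3))) w}.ncard :=
    Set.ncard_le_ncard (by rintro x (rfl | rfl | rfl) <;> assumption) (Set.toFinite _)
  have h2 : ({Fin.last (k + 3)} : Set (Fin (k + 4))).ncard ≤
      {i | C.comp i = C.comp (Fin.last (k + 3))}.ncard :=
    Set.ncard_le_ncard (by rintro x rfl; rfl) (Set.toFinite _)
  rw [Set.ncard_singleton] at h2
  rw [Set.ncard_eq_three.2 ⟨a, b, c, hba.symm, Ne.symm hca, hbc, rfl⟩] at h1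
  unfold special
  omega

lemma last_adj_unique' (C : StableCurve (k + 4))
    (h : ¬ 4 ≤ C.special (C.comp (Fin.last (k + 3)))) (i : Fin (k + 3))
    (hi : C.comp i.castSucc = C.comp (Fin.last (k + 3))) (a b : C.V)
    (ha : C.graph.Adj (C.comp (Fin.last (k + 3))) a)
    (hb : C.graph.Adj (C.comp (Fin.last (k + 3))) b) : a = b := by
  classical
  by_contra hab
  apply h
  have h1 : ({a, b} : Set C.V).ncard ≤ {w | C.graph.Adj (C.comp (Fin.last (k + 3))) w}.ncard :=
    Set.ncard_le_ncard (by rintro x (rfl | rfl) <;> assumption) (Set.toFinite _)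
  have h2 : ({Fin.last (k + 3), i.castSucc} : Set (Fin (k + 4))).ncard ≤
      {i | C.comp i = C.comp (Fin.last (k + 3))}.ncard :=
    Set.ncard_le_ncard (by rintro x (rfl | rfl); exacts [rfl, hi]) (Set.toFinite _)
  rw [Set.ncard_pair (Fin.castSucc_lt_last i).ne'] at h2
  rw [Set.ncard_pair hab] at h1
  unfold special
  omega

lemma last_mark_unique (C : StableCurve (k + 4))
    (h : ¬ 4 ≤ C.special (C.comp (Fin.last (k + 3)))) (i j : Fin (k + 3))
    (hi : C.comp i.castSucc = C.comp (Fin.last (k + 3)))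
    (hj : C.comp j.castSucc = C.comp (Fin.last (k + 3))) : i = j := by
  classical
  by_contra hij
  obtain ⟨a, ha⟩ := C.exists_adj_last h
  apply h
  have h1 : ({a} : Set C.V).ncard ≤ {w | C.graph.Adj (C.comp (Fin.last (k + 3))) w}.ncard :=
    Set.ncard_le_ncard (by rintro x rfl; assumption) (Set.toFinite _)
  have h2 : ({Fin.last (k + 3), i.castSucc, j.castSucc} : Set (Fin (k + 4))).ncard ≤
      {i | C.comp i = C.comp (Fin.last (k + 3))}.ncard :=
    Set.ncard_le_ncard (by rintro x (rfl | rfl | rfl); exacts [rfl, hi, hj]) (Set.toFinite _)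
  rw [Set.ncard_eq_three.2 ⟨_, _, _, (Fin.castSucc_lt_last i).ne', (Fin.castSucc_lt_last j).ne',
    fun h => hij (Fin.castSucc_injective _ h), rfl⟩] at h2
  rw [Set.ncard_singleton] at h1
  unfold special
  omega

/-- A component that meets the one which carries the last marked point. -/
def neighbor (C : StableCurve (k + 4)) (h : ¬ 4 ≤ C.special (C.comp (Fin.last (k + 3)))) : C.V :=
  (C.exists_adj_last h).choose

lemma adj_neighbor (C : StableCurve (k + 4))
    (h : ¬ 4 ≤ C.special (C.comp (Fin.last (k + 3)))) :
    C.graph.Adj (C.comp (Fin.last (k + 3))) (C.neighbor h) :=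
  (C.exists_adj_last h).choose_spec

lemma contract_stable (C : StableCurve (k + 4))
    (h : ¬ 4 ≤ C.special (C.comp (Fin.last (k + 3))))
    (comp' : Fin (k + 3) → {v : C.V // v ≠ C.comp (Fin.last (k + 3))})
    (h₁ : ∀ i, C.comp i.castSucc = C.comp (Fin.last (k + 3)) → (comp' i).1 = C.neighbor h)
    (h₂ : ∀ i, C.comp i.castSucc ≠ C.comp (Fin.last (k + 3)) → (comp' i).1 = C.comp i.castSucc)
    (v : {v : C.V // v ≠ C.comp (Fin.last (k + 3))}) :
    3 ≤ {w | (contractGraph C.graph (C.comp (Fin.last (k + 3)))).Adj v w}.ncard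
      + {i | comp' i = v}.ncard := by
  classical
  have hst := C.stable v.1
  have hm : {i : Fin (k + 4) | C.comp i = v.1}.ncard ≤
      {i : Fin (k + 3) | C.comp i.castSucc = v.1}.ncard := ncard_marks_le' C.comp v.1 v.2.symm
  have hmsub : {i : Fin (k + 3) | C.comp i.castSucc = v.1} ⊆ {i | comp' i = v} := by
    intro i hi
    refine Subtype.ext ((h₂ i ?_).trans hi)
    intro h'
    exact v.2 (hi.symm.trans h')
  have hm' := Set.ncard_le_ncard hmsub (Set.toFinite _)
  let A : Set {v : C.V // v ≠ C.comp (Fin.last (k + 3))} := {w | C.graph.Adj v w}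
  have hA : A ⊆ {w | (contractGraph C.graph (C.comp (Fin.last (k + 3)))).Adj v w} := fun w hw => Or.inl hw
  have hA' := Set.ncard_le_ncard hA (Set.toFinite _)
  have hAi : (Subtype.val '' A).ncard = A.ncard :=
    Set.ncard_image_of_injective _ Subtype.val_injective
  by_cases hadj : C.graph.Adj (C.comp (Fin.last (k + 3))) v.1
  · have hn : {w | C.graph.Adj v.1 w}.ncard ≤ A.ncard + 1 := by
      rw [← hAi]
      refine (Set.ncard_le_ncard ?_ (Set.toFinite _)).trans (Set.ncard_insert_le (C.comp (Fin.last (k + 3))) _)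
      intro w hw
      by_cases hw0 : w = (C.comp (Fin.last (k + 3)))
      · exact Or.inl hw0
      · exact Or.inr ⟨⟨w, hw0⟩, hw, rfl⟩
    by_cases hb : ∃ b, C.graph.Adj (C.comp (Fin.last (k + 3))) b ∧ b ≠ v.1
    · obtain ⟨b, hb, hbv⟩ := hb
      have hbA : (⟨b, hb.ne'⟩ : {v : C.V // v ≠ C.comp (Fin.last (k + 3))}) ∉ A := by
        intro (hvb : C.graph.Adj v.1 b)
        have hne : v.1 ≠ b := hbv.symm
        have h3 := (C.isTree.isAcyclic.subsingleton_path v.1 b).elim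
          ⟨.cons hvb .nil, by simp [hne]⟩
          ⟨.cons hadj.symm (.cons hb .nil), by simp [hne, hadj.ne', hb.ne]⟩
        have h4 := congrArg (fun p : C.graph.Path v.1 b => p.1.length) h3
        simp at h4
      have h5 : (insert (⟨b, hb.ne'⟩ : {v : C.V // v ≠ C.comp (Fin.last (k + 3))}) A).ncard ≤
          {w | (contractGraph C.graph (C.comp (Fin.last (k + 3)))).Adj v w}.ncard := by
        refine Set.ncard_le_ncard (Set.insert_subset ?_ hA) (Set.toFinite _)
        exact Or.inr ⟨hadj, hb, fun h => hbv (congrArg Subtype.val h).symm⟩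
      rw [Set.ncard_insert_of_notMem hbA (Set.toFinite _)] at h5
      omega
    · push Not at hb
      have hN : {w | C.graph.Adj (C.comp (Fin.last (k + 3))) w} = {v.1} := by
        ext w
        exact ⟨fun hw => hb w hw, fun hw => by rw [hw]; exact hadj⟩
      have h6 := C.stable (C.comp (Fin.last (k + 3)))
      rw [hN, Set.ncard_singleton] at h6
      have h7 : {i : Fin (k + 4) | C.comp i = C.comp (Fin.last (k + 3))}.ncard ≤
          {i : Fin (k + 3) | C.comp i.castSucc = C.comp (Fin.last (k + 3))}.ncard + 1 :=
        ncard_marks_le C.comp (C.comp (Fin.last (k + 3)))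
      have h8 : {i : Fin (k + 3) | C.comp i.castSucc = (C.comp (Fin.last (k + 3)))}.ncard ≠ 0 := by omega
      obtain ⟨i, hi⟩ := Set.nonempty_of_ncard_ne_zero h8
      have h9 : (insert i {i : Fin (k + 3) | C.comp i.castSucc = v.1}).ncard ≤
          {i | comp' i = v}.ncard := by
        refine Set.ncard_le_ncard (Set.insert_subset ?_ hmsub) (Set.toFinite _)
        exact Subtype.ext ((h₁ i hi).trans (hb _ (C.adj_neighbor h)))
      have h10 : i ∉ {i : Fin (k + 3) | C.comp i.castSucc = v.1} :=
        fun h' => v.2 (Eq.trans (Eq.symm h') hi)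
      rw [Set.ncard_insert_of_notMem h10 (Set.toFinite _)] at h9
      omega
  · have hn : {w | C.graph.Adj v.1 w}.ncard ≤ A.ncard := by
      rw [← hAi]
      refine Set.ncard_le_ncard ?_ (Set.toFinite _)
      intro w hw
      have hw0 : w ≠ (C.comp (Fin.last (k + 3))) := by
        intro h'
        have hw' : C.graph.Adj v.1 w := hw
        rw [h'] at hw'
        exact hadj hw'.symm
      exact ⟨⟨w, hw0⟩, hw, rfl⟩
    omega

open Classical in
/-- Drop the last marked point when its component `v₀` has exactly two other special points, and
contract `v₀` to a point. If these two are nodes, then the two components that meet `v₀` are glued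
to each other at the points where they were glued to `v₀`. If they are a node and a marked point
`i`, then the `i`-th marked point becomes the point where the component that meets `v₀` was glued
to `v₀`. -/
def contract (C : StableCurve (k + 4)) (h : ¬ 4 ≤ C.special (C.comp (Fin.last (k + 3)))) :
    StableCurve (k + 3) where
  V := {v : C.V // v ≠ C.comp (Fin.last (k + 3))}
  finite := inferInstance
  graph := contractGraph C.graph (C.comp (Fin.last (k + 3)))
  isTree := contractGraph_isTree _ C.isTree _ _ (C.adj_neighbor h) fun b c hb hc =>
    C.last_adj_unique h _ b c (C.adj_neighbor h) hb hc
  node v w := if C.graph.Adj v w then C.node v w else C.node v (C.comp (Fin.last (k + 3)))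
  comp i :=
    if hi : C.comp i.castSucc = C.comp (Fin.last (k + 3))
    then ⟨C.neighbor h, (C.adj_neighbor h).ne'⟩
    else ⟨C.comp i.castSucc, hi⟩
  mark i :=
    if C.comp i.castSucc = C.comp (Fin.last (k + 3))
    then C.node (C.neighbor h) (C.comp (Fin.last (k + 3)))
    else C.mark i.castSucc
  node_inj v w w' hw hw' he := by
    apply Subtype.ext
    by_cases h1 : C.graph.Adj v w <;> by_cases h2 : C.graph.Adj v w'
    · rw [if_pos h1, if_pos h2] at he
      exact C.node_inj _ _ _ h1 h2 he
    · rw [if_pos h1, if_neg h2] at he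
      have h3 := hw'.resolve_left h2
      exact absurd (C.node_inj _ _ _ h1 h3.1.symm he) w.2
    · rw [if_neg h1, if_pos h2] at he
      have h3 := hw.resolve_left h1
      exact absurd (C.node_inj _ _ _ h2 h3.1.symm he.symm) w'.2
    · have h3 := hw.resolve_left h1
      have h4 := hw'.resolve_left h2
      exact C.last_adj_unique h v w w' h3.1 h3.2.1 h4.2.1
        (fun h => h3.2.2 (Subtype.ext h.symm)) (fun h => h4.2.2 (Subtype.ext h.symm))
  mark_inj i j hc he := by
    by_cases h1 : C.comp i.castSucc = C.comp (Fin.last (k + 3)) <;>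
      by_cases h2 : C.comp j.castSucc = C.comp (Fin.last (k + 3))
    · exact C.last_mark_unique h i j h1 h2
    · rw [dif_pos h1, dif_neg h2] at hc
      rw [if_pos h1, if_neg h2] at he
      have hc' : C.neighbor h = C.comp j.castSucc := congrArg Subtype.val hc
      rw [hc'] at he
      exact absurd he.symm (C.mark_ne_node _ _ (hc' ▸ (C.adj_neighbor h).symm))
    · rw [dif_neg h1, dif_pos h2] at hc
      rw [if_neg h1, if_pos h2] at he
      have hc' : C.comp i.castSucc = C.neighbor h := congrArg Subtype.val hc
      rw [← hc'] at he
      exact absurd he (C.mark_ne_node _ _ (hc' ▸ (C.adj_neighbor h).symm))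
    · rw [dif_neg h1, dif_neg h2] at hc
      rw [if_neg h1, if_neg h2] at he
      exact Fin.castSucc_injective _ (C.mark_inj _ _ (congrArg Subtype.val hc) he)
  mark_ne_node i w hw he := by
    by_cases h1 : C.comp i.castSucc = C.comp (Fin.last (k + 3))
    · simp only [dif_pos h1, if_pos h1] at hw he
      split_ifs at he with h2
      · exact w.2 (C.node_inj _ _ _ (C.adj_neighbor h).symm h2 he).symm
      · have h3 := hw.resolve_left h2
        exact h3.2.2 (Subtype.ext (C.last_adj_unique' h i h1 _ _ h3.1 h3.2.1))
    · simp only [dif_neg h1, if_neg h1] at hw he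
      split_ifs at he with h2
      · exact C.mark_ne_node _ _ h2 he
      · have h3 := hw.resolve_left h2
        exact C.mark_ne_node _ _ h3.1.symm he
  stable := C.contract_stable h _ (fun i hi => by rw [dif_pos hi]) (fun i hi => by rw [dif_neg hi])

open Classical in
/-- Forget the last marked point and stabilize. -/
def forget (C : StableCurve (k + 4)) : StableCurve (k + 3) :=
  if h : 4 ≤ C.special (C.comp (Fin.last (k + 3))) then C.dropMark h else C.contract h

lemma Iso.special_eq {n : ℕ} {C D : StableCurve n} (e : Iso C D) (v : C.V) :
    D.special (e.toEquiv v) = C.special v := by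
  unfold special
  congr 1
  · rw [← Set.ncard_image_of_injective {w | C.graph.Adj v w} e.toEquiv.injective]
    congr 1
    ext w
    constructor
    · intro hw
      refine ⟨e.toEquiv.symm w, ?_, by simp⟩
      rw [Set.mem_ofPred_eq, ← e.adj_iff]
      simpa using hw
    · rintro ⟨w, hw, rfl⟩
      exact (e.adj_iff _ _).2 hw
  · congr 1
    ext i
    simp [e.comp_eq]

lemma forget_iso {C D : StableCurve (k + 4)} (e : Iso C D) : Nonempty (Iso C.forget D.forget) := by
  classical
  have hlast := e.comp_eq (Fin.last (k + 3))
  have hs : D.special (D.comp (Fin.last (k + 3))) = C.special (C.comp (Fin.last (k + 3))) := by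
    rw [hlast, e.special_eq]
  unfold forget
  by_cases h : 4 ≤ C.special (C.comp (Fin.last (k + 3)))
  · have h' : 4 ≤ D.special (D.comp (Fin.last (k + 3))) := hs ▸ h
    rw [dif_pos h, dif_pos h']
    exact ⟨{
      toEquiv := e.toEquiv
      adj_iff := e.adj_iff
      aut := e.aut
      node_eq := e.node_eq
      comp_eq := fun i => e.comp_eq _
      mark_eq := fun i => e.mark_eq _ }⟩
  · have h' : ¬ 4 ≤ D.special (D.comp (Fin.last (k + 3))) := hs ▸ h
    rw [dif_neg h, dif_neg h']
    have hc : ∀ i : Fin (k + 3), D.comp i.castSucc = D.comp (Fin.last (k + 3)) ↔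
        C.comp i.castSucc = C.comp (Fin.last (k + 3)) := fun i => by
      rw [hlast, e.comp_eq]; exact e.toEquiv.injective.eq_iff
    have hadj0 : ∀ v, D.graph.Adj (D.comp (Fin.last (k + 3))) (e.toEquiv v) ↔
        C.graph.Adj (C.comp (Fin.last (k + 3))) v := fun v => by rw [hlast, e.adj_iff]
    have hnb : ∀ i : Fin (k + 3), C.comp i.castSucc = C.comp (Fin.last (k + 3)) →
        D.neighbor h' = e.toEquiv (C.neighbor h) := fun i hi =>
      D.last_adj_unique' h' i ((hc i).2 hi) _ _ (D.adj_neighbor h')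
        ((hadj0 _).2 (C.adj_neighbor h))
    exact ⟨{
      toEquiv := e.toEquiv.subtypeEquiv fun _ => by
        rw [hlast]; exact (e.toEquiv.injective.ne_iff).symm
      adj_iff := fun v w => by
        have h1 := e.adj_iff v.1 w.1
        have h2 := hadj0 v.1
        have h3 := hadj0 w.1
        have h4 : e.toEquiv v.1 ≠ e.toEquiv w.1 ↔ v.1 ≠ w.1 := e.toEquiv.injective.ne_iff
        have h5 : v ≠ w ↔ v.1 ≠ w.1 := Subtype.coe_injective.ne_iff.symm
        change (D.graph.Adj (e.toEquiv v.1) (e.toEquiv w.1) ∨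
          (D.graph.Adj (D.comp (Fin.last (k + 3))) (e.toEquiv v.1) ∧
            D.graph.Adj (D.comp (Fin.last (k + 3))) (e.toEquiv w.1) ∧ _ ≠ _)) ↔
          (C.graph.Adj v.1 w.1 ∨ (C.graph.Adj (C.comp (Fin.last (k + 3))) v.1 ∧
            C.graph.Adj (C.comp (Fin.last (k + 3))) w.1 ∧ v ≠ w))
        rw [h1, h2, h3, h5, ← h4]
        exact or_congr Iff.rfl (and_congr Iff.rfl (and_congr Iff.rfl
          Subtype.coe_injective.ne_iff.symm))
      aut := fun v => e.aut v.1
      node_eq := fun v w hvw => by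
        change (if D.graph.Adj (e.toEquiv v.1) (e.toEquiv w.1) then
            D.node (e.toEquiv v.1) (e.toEquiv w.1)
          else D.node (e.toEquiv v.1) (D.comp (Fin.last (k + 3)))) =
          e.aut v.1 • (if C.graph.Adj v.1 w.1 then C.node v.1 w.1
            else C.node v.1 (C.comp (Fin.last (k + 3))))
        by_cases h1 : C.graph.Adj v.1 w.1
        · rw [if_pos h1, if_pos ((e.adj_iff _ _).2 h1), e.node_eq _ _ h1]
        · have h2 := (hvw.resolve_left h1).1
          rw [if_neg h1, if_neg (fun h => h1 ((e.adj_iff _ _).1 h)), hlast, e.node_eq _ _ h2.symm]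
      comp_eq := fun i => by
        apply Subtype.ext
        by_cases hi : C.comp i.castSucc = C.comp (Fin.last (k + 3))
        · simp only [contract, hi, (hc i).2 hi, dite_true]
          exact hnb i hi
        · simp only [contract, hi, mt (hc i).1 hi, dite_false]
          exact e.comp_eq _
      mark_eq := fun i => by
        by_cases hi : C.comp i.castSucc = C.comp (Fin.last (k + 3))
        · simp only [contract, hi, (hc i).2 hi, dite_true, if_true]
          rw [hnb i hi, hlast, e.node_eq _ _ (C.adj_neighbor h).symm]
        · simp only [contract, hi, mt (hc i).1 hi, dite_false, if_false]
          exact e.mark_eq _ }⟩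

end Forget

/-! ### The Kapranov map -/

section Kapranov

lemma Iso.next_eq {n : ℕ} {C D : StableCurve n} (e : Iso C D) (v w : C.V) :
    D.next (e.toEquiv v) (e.toEquiv w) = e.toEquiv (C.next v w) := by
  obtain ⟨p, hp⟩ := (C.isTree.existsUnique_path v w).exists
  let f : C.graph ↪g D.graph := ⟨e.toEquiv.toEmbedding, e.adj_iff _ _⟩
  have h := D.next_eq (p.map f.toHom) (hp.map f.injective)
  rw [SimpleGraph.Walk.snd, SimpleGraph.Walk.getVert_map] at h
  rw [C.next_eq p hp]
  exact h

lemma next_adj {n : ℕ} (C : StableCurve n) {v w : C.V} (h : v ≠ w) :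
    C.graph.Adj v (C.next v w) := by
  obtain ⟨p, hp⟩ := (C.isTree.existsUnique_path v w).exists
  rw [C.next_eq p hp]
  exact p.adj_snd (SimpleGraph.Walk.not_nil_of_ne h)

lemma Iso.proj_eq {n : ℕ} {C D : StableCurve n} (e : Iso C D) (v : C.V) (i : Fin n) :
    D.proj (e.toEquiv v) i = e.aut v • C.proj v i := by
  unfold proj
  by_cases h : C.comp i = v
  · rw [if_pos h, if_pos (by rw [e.comp_eq, h]), e.mark_eq, h]
  · rw [if_neg h, if_neg (by rw [e.comp_eq]; exact fun h' => h (e.toEquiv.injective h')),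
      e.comp_eq, e.next_eq, e.node_eq _ _ (C.next_adj (Ne.symm h))]

/-- Every node of a component separates it from some marked point. -/
lemma exists_mark_next {n : ℕ} (C : StableCurve n) {v u : C.V} (h : C.graph.Adj v u) :
    ∃ i, C.comp i ≠ v ∧ C.next v (C.comp i) = u := by
  classical
  have hfin : {w | w ≠ v ∧ C.next v w = u}.Finite := Set.toFinite _
  have hu : u ∈ {w | w ≠ v ∧ C.next v w = u} := by
    refine ⟨h.ne', ?_⟩
    rw [C.next_eq (.cons h .nil) (by simp [h.ne])]
    simp
  obtain ⟨w, ⟨hwv, hwu⟩, hmax⟩ := Set.exists_max_image _ (fun w => C.graph.dist v w) hfin ⟨u, hu⟩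
  by_contra! hno
  have hm : {i | C.comp i = w} = ∅ := by
    rw [Set.eq_empty_iff_forall_notMem]
    rintro i rfl
    exact hno i hwv hwu
  have hst := C.stable w
  rw [hm, Set.ncard_empty, add_zero] at hst
  obtain ⟨p, hp⟩ := (C.isTree.existsUnique_path v w).exists
  obtain ⟨w', hw', hne⟩ := Set.exists_ne_of_one_lt_ncard
    (by omega : 1 < {u | C.graph.Adj w u}.ncard) p.penultimate
  have hw'' : C.graph.Adj w w' := hw'
  have hns : w' ∉ p.support := by
    intro hmem
    apply hne
    exact C.isTree.isAcyclic.eq_penultimate_of_adj_end hp hw'' hmem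
  have hq : (p.concat hw'').IsPath := hp.concat hns hw''
  have hvw' : w' ≠ v := fun h' => hns (h' ▸ p.start_mem_support)
  have hnx : C.next v w' = u := by
    rw [C.next_eq _ hq, ← hwu, C.next_eq p hp]
    cases p with
    | nil => exact absurd rfl hwv
    | cons h' q => simp [SimpleGraph.Walk.concat_cons]
  have h1 := hmax w' ⟨hvw', hnx⟩
  have h2 := C.isTree.dist_eq_dist_add_one_of_adj v hw''
  have h3 : C.graph.dist v w' = p.length + 1 := by
    obtain ⟨q, hq', hql⟩ := C.isTree.connected.exists_path_of_dist v w'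
    rw [← hql, (C.isTree.existsUnique_path v w').unique hq' hq]
    simp
  have h4 := SimpleGraph.dist_le p
  omega

variable {k : ℕ}

/-- The coordinates `(p₁ - pⱼ) / (pₙ - pⱼ)`, `2 ≤ j ≤ n - 1`, where `n = k + 3`. On a curve with
several components, `p₁, …, pₙ` are replaced by their projections to the component that carries
the last marked point `pₙ`. -/
def kapranovVec (C : StableCurve (k + 3)) (j : Fin (k + 1)) : ℂ :=
  bracket (C.proj (C.comp (Fin.last (k + 2))) 0)
      (C.proj (C.comp (Fin.last (k + 2))) j.succ.castSucc) /
    bracket (C.proj (C.comp (Fin.last (k + 2))) (Fin.last (k + 2)))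
      (C.proj (C.comp (Fin.last (k + 2))) j.succ.castSucc)

lemma proj_ne_last (C : StableCurve (k + 3)) (i : Fin (k + 2)) :
    C.proj (C.comp (Fin.last (k + 2))) (Fin.last (k + 2)) ≠
      C.proj (C.comp (Fin.last (k + 2))) i.castSucc := by
  unfold proj
  rw [if_pos rfl]
  split_ifs with h
  · intro h'
    exact (Fin.castSucc_lt_last i).ne' (C.mark_inj _ _ h.symm h')
  · exact C.mark_ne_node _ _ (C.next_adj (Ne.symm h))

lemma kapranovVec_ne_zero (C : StableCurve (k + 3)) : C.kapranovVec ≠ 0 := by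
  classical
  intro h0
  set v := C.comp (Fin.last (k + 2)) with hv
  have hall : ∀ i : Fin (k + 2), C.proj v i.castSucc = C.proj v 0 := by
    intro i
    induction i using Fin.cases with
    | zero => rfl
    | succ j =>
      have h1 : C.kapranovVec j = 0 := congrFun h0 j
      unfold kapranovVec at h1
      rcases div_eq_zero_iff.1 h1 with h1 | h1
      · exact ((bracket_eq_zero_iff _ _).1 h1).symm
      · exact absurd ((bracket_eq_zero_iff _ _).1 h1) (C.proj_ne_last _)
  have hnode : ∀ u, C.graph.Adj v u → C.node v u = C.proj v 0 := by
    intro u hu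
    obtain ⟨i, hi, hiu⟩ := C.exists_mark_next hu
    induction i using Fin.lastCases with
    | last => exact absurd rfl hi
    | cast i =>
      rw [← hall i]
      unfold proj
      rw [if_neg hi, hiu]
  have hmark : ∀ i : Fin (k + 2), C.comp i.castSucc = v → C.mark i.castSucc = C.proj v 0 := by
    intro i hi
    rw [← hall i]
    unfold proj
    rw [if_pos hi]
  have hN : {w | C.graph.Adj v w}.ncard ≤ 1 :=
    (Set.ncard_le_one_iff (Set.toFinite _)).2 fun {a b} ha hb =>
      C.node_inj v a b ha hb ((hnode a ha).trans (hnode b hb).symm)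
  have hM : {i : Fin (k + 2) | C.comp i.castSucc = v}.ncard ≤ 1 :=
    (Set.ncard_le_one_iff (Set.toFinite _)).2 fun {a b} ha hb => Fin.castSucc_injective _
      (C.mark_inj _ _ (Eq.trans ha (Eq.symm hb)) ((hmark a ha).trans (hmark b hb).symm))
  have hM' : {i : Fin (k + 3) | C.comp i = v}.ncard ≤
    {i : Fin (k + 2) | C.comp i.castSucc = v}.ncard + 1 := ncard_marks_le C.comp v
  have hst := C.stable v
  obtain ⟨w, hw⟩ := Set.nonempty_of_ncard_ne_zero (s := {w | C.graph.Adj v w}) (by omega)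
  obtain ⟨i, hi⟩ := Set.nonempty_of_ncard_ne_zero
    (s := {i : Fin (k + 2) | C.comp i.castSucc = v}) (by omega)
  have hi' : C.comp i.castSucc = v := hi
  apply C.mark_ne_node i.castSucc w (by rw [hi']; exact hw)
  rw [hi', hmark i hi', hnode w hw]

/-- The Kapranov map `ψₙ` on curves, with `n = k + 3`. Its coordinates are the values at `pₙ`
of the logarithmic one-forms on the curve which have their poles at `p₁` and `pⱼ`, with residues
`±1` independent of `j`. -/
def kapranov (C : StableCurve (k + 3)) : ℙ ℂ (Fin (k + 1) → ℂ) :=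
  Projectivization.mk ℂ C.kapranovVec C.kapranovVec_ne_zero

lemma kapranov_iso {C D : StableCurve (k + 3)} (e : Iso C D) : C.kapranov = D.kapranov := by
  unfold kapranov
  rw [Projectivization.mk_eq_mk_iff']
  obtain ⟨d, c, hd, hc, h⟩ := bracket_smul (e.aut (C.comp (Fin.last (k + 2))))
  refine ⟨c (C.proj (C.comp (Fin.last (k + 2))) (Fin.last (k + 2))) /
    c (C.proj (C.comp (Fin.last (k + 2))) 0), ?_⟩
  ext j
  simp only [Pi.smul_apply, smul_eq_mul, kapranovVec]
  rw [e.comp_eq, e.proj_eq, e.proj_eq, e.proj_eq, h, h]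
  have h1 := (bracket_eq_zero_iff _ _).not.2 (C.proj_ne_last j.succ)
  have h2 := hc (C.proj (C.comp (Fin.last (k + 2))) 0)
  have h3 := hc (C.proj (C.comp (Fin.last (k + 2))) (Fin.last (k + 2)))
  have h4 := hc (C.proj (C.comp (Fin.last (k + 2))) j.succ.castSucc)
  field_simp

end Kapranov

end StableCurve

/-- The set of complex points of the moduli space of stable `n`-pointed rational curves. -/
def Mbar (n : ℕ) : Type 1 := Quotient (StableCurve.isoSetoid n)

/-- The forgetful map, which forgets the last marked point and stabilizes. -/
def Mbar.forget {k : ℕ} : Mbar (k + 4) → Mbar (k + 3) :=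
  Quotient.map StableCurve.forget fun _ _ ⟨e⟩ => StableCurve.forget_iso e

/-- The Kapranov map. -/
def Mbar.kapranov {k : ℕ} : Mbar (k + 3) → ℙ ℂ (Fin (k + 1) → ℂ) :=
  Quotient.lift StableCurve.kapranov fun _ _ ⟨e⟩ => StableCurve.kapranov_iso e

/-- The embedding of the moduli space of stable `5`-pointed rational curves in `ℙ¹ × ℙ²`: the
Kapranov map after forgetting the fifth point, and the Kapranov map. If the curve is `P1` with the
marked points `p₁, …, p₅`, then the image is
`([(p₁-p₂)/(p₄-p₂) : (p₁-p₃)/(p₄-p₃)], [(p₁-p₂)/(p₅-p₂) : (p₁-p₃)/(p₅-p₃) : (p₁-p₄)/(p₅-p₄)])`. -/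
def phi (x : Mbar 5) : ℙ ℂ (Fin 2 → ℂ) × ℙ ℂ (Fin 3 → ℂ) :=
  (Mbar.kapranov (k := 1) (Mbar.forget (k := 1) x), Mbar.kapranov (k := 2) x)

/-! ### Bihomogeneous polynomials on `ℙ¹ × ℙ²` -/

/-- The Cox ring `ℂ[a₀, a₁, b₀, b₁, b₂]` of `ℙ¹ × ℙ²`. -/
abbrev Cox : Type := MvPolynomial (Fin 2 ⊕ Fin 3) ℂ

/-- The bigrading of the Cox ring: the `aᵢ` have degree `(1, 0)`, the `bⱼ` degree `(0, 1)`. -/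
def bidegree : Fin 2 ⊕ Fin 3 → ℕ × ℕ := Sum.elim (fun _ => (1, 0)) (fun _ => (0, 1))

def IsBihomogeneous (F : Cox) : Prop := ∃ d, MvPolynomial.IsWeightedHomogeneous bidegree F d

/-- `F` vanishes at a point of `ℙ¹ × ℙ²`, for every choice of homogeneous coordinates. -/
def VanishesAt (F : Cox) (x : ℙ ℂ (Fin 2 → ℂ) × ℙ ℂ (Fin 3 → ℂ)) : Prop :=
  ∀ (a : Fin 2 → ℂ) (b : Fin 3 → ℂ) (ha : a ≠ 0) (hb : b ≠ 0),
    Projectivization.mk ℂ a ha = x.1 → Projectivization.mk ℂ b hb = x.2 →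
      MvPolynomial.eval (Sum.elim a b) F = 0

/-- The bihomogeneous ideal of a subset of `ℙ¹ × ℙ²`: it is generated by the bihomogeneous
polynomials which vanish on the subset. -/
def vanishingIdeal (X : Set (ℙ ℂ (Fin 2 → ℂ) × ℙ ℂ (Fin 3 → ℂ))) : Ideal Cox :=
  Ideal.span {F | IsBihomogeneous F ∧ ∀ x ∈ X, VanishesAt F x}

/-- `a₀ b₁ (b₀ - b₂) - a₁ b₀ (b₁ - b₂)` -/
def equation : Cox :=
  .X (.inl 0) * .X (.inr 1) * (.X (.inr 0) - .X (.inr 2)) -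
    .X (.inl 1) * .X (.inr 0) * (.X (.inr 1) - .X (.inr 2))

/-- The quadratic form in `b₀, b₁, b₂` obtained from `equation` for a given value of `a`. -/
def conic (a : Fin 2 → ℂ) : MvPolynomial (Fin 3) ℂ :=
  .C (a 0) * .X 1 * (.X 0 - .X 2) - .C (a 1) * .X 0 * (.X 1 - .X 2)

/-- The quadratic forms on `ℙ²` which vanish at the four points
`[1:0:0]`, `[0:1:0]`, `[0:0:1]` and `[1:1:1]`. -/
def quadricsThroughFourPoints : Set (MvPolynomial (Fin 3) ℂ) :=
  {Q | Q.IsHomogeneous 2 ∧ MvPolynomial.eval ![1, 0, 0] Q = 0 ∧ MvPolynomial.eval ![0, 1, 0] Q = 0 ∧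
    MvPolynomial.eval ![0, 0, 1] Q = 0 ∧ MvPolynomial.eval ![1, 1, 1] Q = 0}

end PointedCurves

end

/-! A component `v` of a stable curve sees the marked points as a family `C.proj v` in `P1`, at
least three of whose values are distinct. These families, up to projective transformations,
determine the curve (`iso_of_proj`). For two components `v ≠ w`, every marked point is seen from `v`
in the direction of `w` or from `w` in the direction of `v` (`proj_or_proj`). Hence cross-ratios of
marked points, compared in cross-multiplied form, agree on all components (`crossRatioEq_proj`).

Put `p₁` at `0` and `p₅` at infinity on the component of `p₅`. Up to a common factor the Kapranov
coordinates `b` are then the affine coordinates of `p₂, p₃, p₄`. The point `[a]` is the cross-ratio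
of the first four marked points, since stabilization does not change projections. The equation of
the pencil says that `[a]` is the cross-ratio of `0, b₀, b₁, b₂` (`equation_kapranovVec`).

Injectivity (`exists_proj_equiv`): the cross-ratios involving `p₅` are recovered from `b` when they
are defined on the component of `p₅`, and from `a` otherwise. Surjectivity (`mem_range_phi_iff`):
away from the base points `b` dictates a curve with a central component; over a base point `a` does,
with `p₅` and one other marked point on an attached component.

For the ideal, the pencil is parametrized by `a = (b₀(b₁ - b₂), b₁(b₀ - b₂))`. A bihomogeneous `F`
vanishing on the image vanishes after this substitution, so `equation` divides `F` times a power of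
`b₁(b₀ - b₂)`. Neither `b₁` nor `b₀ - b₂` shares a factor with `equation`, so they cancel
(`equation_dvd`). -/

namespace PointedCurves

namespace StableCurve

/-! ### Directions in the dual tree -/

section Directions

variable {n : ℕ} (C : StableCurve n)

/-- The point of the component `v` in the direction of the component `w`. -/
noncomputable def dir (v w : C.V) : P1 := C.node v (C.next v w)

/-- This is how directions are computed: shortcutting a walk to a path keeps it away from `v`, so no
path has to be exhibited. -/
lemma next_eq_of_walk {v u w : C.V} (h : C.graph.Adj v u) (p : C.graph.Walk u w)
    (hp : v ∉ p.support) : C.next v w = u := by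
  classical
  rw [C.next_eq (.cons h p.bypass)
    (p.bypass_isPath.cons fun h' => hp (p.support_bypass_subset_support h'))]
  simp

lemma next_of_adj {v w : C.V} (h : C.graph.Adj v w) : C.next v w = w :=
  C.next_eq_of_walk h .nil (by simpa using h.ne)

/-- A path that leaves `v` towards `w` gives a walk from the next component which avoids `v`. -/
lemma exists_walk_next {v w : C.V} (h : v ≠ w) :
    ∃ p : C.graph.Walk (C.next v w) w, p.IsPath ∧ v ∉ p.support := by
  obtain ⟨p, hp⟩ := (C.isTree.existsUnique_path v w).exists
  have h1 := C.next_eq p hp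
  cases p with
  | nil => exact absurd rfl h
  | cons h' q =>
    rw [SimpleGraph.Walk.snd_cons] at h1
    rw [h1]
    exact ⟨q, hp.of_cons, (SimpleGraph.Walk.cons_isPath_iff _ _).1 hp |>.2⟩

lemma dist_next_add_one {v w : C.V} (h : v ≠ w) :
    C.graph.dist (C.next v w) w + 1 = C.graph.dist v w := by
  obtain ⟨p, hp, hv⟩ := C.exists_walk_next h
  obtain ⟨q, hq, hql⟩ := C.isTree.connected.exists_path_of_dist v w
  have h1 := (C.isTree.existsUnique_path v w).unique hq (hp.cons (h := C.next_adj h) hv)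
  have h2 := SimpleGraph.dist_le p
  have h3 := C.isTree.connected.dist_triangle (u := v) (v := C.next v w) (w := w)
  have h4 := SimpleGraph.dist_eq_one_iff_adj.2 (C.next_adj h)
  have h5 := congrArg SimpleGraph.Walk.length h1
  rw [SimpleGraph.Walk.length_cons] at h5
  omega

/-- Every third component lies, seen from `v`, in the direction of `w`, or, seen from `w`, in the
direction of `v`. -/
lemma next_or_next {v w : C.V} (h : v ≠ w) (c : C.V) :
    (c ≠ v ∧ C.next v c = C.next v w) ∨ (c ≠ w ∧ C.next w c = C.next w v) := by
  classical
  by_cases hcv : c = v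
  · exact Or.inr ⟨hcv ▸ h, by rw [hcv]⟩
  by_cases hn : C.next v c = C.next v w
  · exact Or.inl ⟨hcv, hn⟩
  have hcw : c ≠ w := fun h' => hn (by rw [h'])
  -- Go from `next w v` to `v` and then on to `c`. If the second half met `w`, then `w` and `c`
  -- would lie in the same direction from `v`, against `hn`.
  obtain ⟨p, hp, hpw⟩ := C.exists_walk_next h.symm
  obtain ⟨q, hq, hqv⟩ := C.exists_walk_next (Ne.symm hcv)
  refine Or.inr ⟨hcw, C.next_eq_of_walk (C.next_adj h.symm)
    (p.append (.cons (C.next_adj (Ne.symm hcv)) q)) ?_⟩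
  rw [SimpleGraph.Walk.mem_support_append_iff, SimpleGraph.Walk.support_cons, List.mem_cons]
  rintro (h' | h' | h')
  · exact hpw h'
  · exact h h'.symm
  · apply hn
    exact (C.next_eq_of_walk (C.next_adj (Ne.symm hcv)) (q.takeUntil w h')
      fun h'' => hqv (q.support_takeUntil_subset_support h' h'')).symm

lemma proj_eq_dir {v : C.V} {i : Fin n} (h : C.comp i ≠ v) : C.proj v i = C.dir v (C.comp i) := by
  unfold proj dir
  rw [if_neg h]

lemma proj_comp (i : Fin n) : C.proj (C.comp i) i = C.mark i := by
  unfold proj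
  rw [if_pos rfl]

lemma proj_or_proj {v w : C.V} (h : v ≠ w) (i : Fin n) :
    C.proj v i = C.dir v w ∨ C.proj w i = C.dir w v := by
  rcases C.next_or_next h (C.comp i) with ⟨h1, h2⟩ | ⟨h1, h2⟩
  · exact Or.inl (by rw [C.proj_eq_dir h1, dir, dir, h2])
  · exact Or.inr (by rw [C.proj_eq_dir h1, dir, dir, h2])

lemma dir_eq_dir_iff {u v w : C.V} (hv : u ≠ v) (hw : u ≠ w) :
    C.dir u v = C.dir u w ↔ C.next u v = C.next u w :=
  ⟨C.node_inj _ _ _ (C.next_adj hv) (C.next_adj hw), fun h => by rw [dir, dir, h]⟩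

lemma next_eq_next_of_adj {u v w : C.V} (h : C.graph.Adj v w) (hv : u ≠ v) (hw : u ≠ w) :
    C.next u v = C.next u w := by
  obtain ⟨p, -, hp⟩ := C.exists_walk_next hv
  refine (C.next_eq_of_walk (C.next_adj hv) (p.concat h) ?_).symm
  rw [SimpleGraph.Walk.support_concat]
  simp [hp, hw]

/-- Two components meet exactly when no third one separates them. If they do not meet, the first
component after `v` on the path to `w` does separate them; otherwise stepping back to `v` would
bring it closer to `w`. Adjacency is thus expressed by directions alone. -/
lemma adj_iff_dir {v w : C.V} (h : v ≠ w) :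
    C.graph.Adj v w ↔ ∀ u, u ≠ v → u ≠ w → C.dir u v = C.dir u w := by
  refine ⟨fun ha u hv hw => (C.dir_eq_dir_iff hv hw).2 (C.next_eq_next_of_adj ha hv hw),
    fun hd => ?_⟩
  by_cases hu : C.next v w = w
  · rw [← hu]; exact C.next_adj h
  have ha := C.next_adj h
  have h1 := (C.dir_eq_dir_iff ha.ne' hu).1 (hd _ ha.ne' hu)
  rw [C.next_of_adj ha.symm] at h1
  have h2 := C.dist_next_add_one hu
  have h3 := C.dist_next_add_one h
  rw [← h1] at h2
  omega

/-- The marked points have at least three different projections to each component. -/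
lemma three_le_ncard_range_proj (v : C.V) : 3 ≤ (Set.range (C.proj v)).ncard := by
  classical
  have hsub : C.node v '' {w | C.graph.Adj v w} ∪ C.mark '' {i | C.comp i = v} ⊆
      Set.range (C.proj v) := by
    rintro _ (⟨u, hu, rfl⟩ | ⟨i, rfl, rfl⟩)
    · obtain ⟨i, hi, hiu⟩ := C.exists_mark_next hu
      exact ⟨i, by rw [C.proj_eq_dir hi, dir, hiu]⟩
    · exact ⟨i, C.proj_comp i⟩
  refine le_trans ?_ (Set.ncard_le_ncard hsub (Set.finite_range _))
  rw [Set.ncard_union_eq _ (Set.toFinite _) (Set.toFinite _),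
    Set.InjOn.ncard_image (s := {w | C.graph.Adj v w})
      fun a ha b hb hab => C.node_inj _ _ _ ha hb hab,
    Set.InjOn.ncard_image (s := {i | C.comp i = v})
      fun a ha b hb hab => C.mark_inj _ _ (Eq.trans ha (Eq.symm hb)) hab]
  · exact C.stable v
  · rw [Set.disjoint_left]
    rintro _ ⟨u, hu, rfl⟩ ⟨i, rfl, hi⟩
    exact C.mark_ne_node i u hu hi

/-- Expresses the position of a marked point by projections. If the point lay on another component
`u`, its projection to `u` would be the point itself, which is not a node. -/
lemma comp_eq_iff (i : Fin n) (v : C.V) :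
    C.comp i = v ↔ ∀ u, u ≠ v → C.proj u i = C.dir u v := by
  constructor
  · rintro rfl u hu
    exact C.proj_eq_dir hu.symm
  · intro h
    by_contra hne
    have h1 := h _ hne
    rw [C.proj_comp] at h1
    exact C.mark_ne_node i _ (C.next_adj hne) h1

/-- Marked points differ from each other and from the nodes, so two of them can only be confused by
`v` when both lie behind the same node. -/
lemma next_eq_of_proj_eq {v : C.V} {i j : Fin n} (hij : i ≠ j) (h : C.proj v i = C.proj v j) :
    C.comp i ≠ v ∧ C.comp j ≠ v ∧ C.next v (C.comp i) = C.next v (C.comp j) := by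
  by_cases hi : C.comp i = v <;> by_cases hj : C.comp j = v
  · subst hi
    rw [C.proj_comp, ← hj, C.proj_comp] at h
    exact absurd (C.mark_inj _ _ hj.symm h) hij
  · subst hi
    rw [C.proj_comp, C.proj_eq_dir hj] at h
    exact absurd h (C.mark_ne_node _ _ (C.next_adj (Ne.symm hj)))
  · subst hj
    rw [C.proj_comp, C.proj_eq_dir hi] at h
    exact absurd h.symm (C.mark_ne_node _ _ (C.next_adj (Ne.symm hi)))
  · refine ⟨hi, hj, ?_⟩
    rw [C.proj_eq_dir hi, C.proj_eq_dir hj] at h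
    exact (C.dir_eq_dir_iff (Ne.symm hi) (Ne.symm hj)).1 h

/-- Three marked points have three different projections to some component. -/
lemma exists_median {i j k : Fin n} (hij : i ≠ j) (hik : i ≠ k) (hjk : j ≠ k) :
    ∃ v, C.proj v i ≠ C.proj v j ∧ C.proj v i ≠ C.proj v k ∧ C.proj v j ≠ C.proj v k := by
  have : Nonempty C.V := C.isTree.connected.nonempty
  -- The median minimizes the sum of the three distances. If two projections agreed, a step in their
  -- common direction would shorten two distances by one and lengthen the third by at most one.
  obtain ⟨v, hv⟩ := Finite.exists_min fun v => C.graph.dist v (C.comp i) +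
    C.graph.dist v (C.comp j) + C.graph.dist v (C.comp k)
  have key : ∀ a b c, a ≠ b → C.proj v a = C.proj v b → ∃ u,
      C.graph.dist u (C.comp a) + C.graph.dist u (C.comp b) + C.graph.dist u (C.comp c) <
      C.graph.dist v (C.comp a) + C.graph.dist v (C.comp b) + C.graph.dist v (C.comp c) := by
    intro a b c hab h
    obtain ⟨h1, h2, h3⟩ := C.next_eq_of_proj_eq hab h
    have h4 := C.dist_next_add_one h1.symm
    have h5 := C.dist_next_add_one h2.symm
    rw [← h3] at h5
    have h6 := C.isTree.connected.dist_triangle (u := C.next v (C.comp a)) (v := v) (w := C.comp c)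
    have h7 := SimpleGraph.dist_eq_one_iff_adj.2 (C.next_adj h1.symm).symm
    exact ⟨C.next v (C.comp a), by omega⟩
  refine ⟨v, fun h => ?_, fun h => ?_, fun h => ?_⟩
  · obtain ⟨u, hu⟩ := key i j k hij h
    have := hv u
    omega
  · obtain ⟨u, hu⟩ := key i k j hik h
    have := hv u
    omega
  · obtain ⟨u, hu⟩ := key j k i hjk h
    have := hv u
    omega

/-- Stability in the form used below: two values never exhaust the projections. -/
lemma exists_proj_ne_ne (v : C.V) (x y : P1) : ∃ i, C.proj v i ≠ x ∧ C.proj v i ≠ y := by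
  classical
  by_contra! h
  have h1 : Set.range (C.proj v) ⊆ {x, y} := by
    rintro _ ⟨i, rfl⟩
    by_cases hi : C.proj v i = x
    · exact Or.inl hi
    · exact Or.inr (h i hi)
  have h2 := Set.ncard_le_ncard h1 (Set.toFinite _)
  have h3 := Set.ncard_insert_le x {y}
  rw [Set.ncard_singleton] at h3
  have := C.three_le_ncard_range_proj v
  omega

/-- The directions of two components from each other are determined by the projections of the
marked points. -/
lemma dir_eq_of_forall_proj {v w : C.V} (h : v ≠ w) {x y : P1}
    (hxy : ∀ i, C.proj v i = x ∨ C.proj w i = y) : C.dir v w = x := by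
  by_contra hne
  -- This `i` escapes both first alternatives, which forces `y = dir w v`. A marked point whose
  -- projection to `w` is not `y` then projects to `v` at both `x` and `dir v w`.
  obtain ⟨i, h1, h2⟩ := C.exists_proj_ne_ne v (C.dir v w) x
  have hy : C.dir w v = y := by
    rw [← (C.proj_or_proj h i).resolve_left h1, (hxy i).resolve_left h2]
  obtain ⟨j, hj, -⟩ := C.exists_proj_ne_ne w y y
  apply hne
  rw [← (hxy j).resolve_right hj]
  exact ((C.proj_or_proj h j).resolve_right (hy ▸ hj)).symm

/-- If `v ≠ w`, every projection to `v` would be `dir v w` or the preimage under `g` of `dir w v`,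
which leaves only two values. -/
lemma eq_of_proj_smul {v w : C.V} (g : Aut2) (h : ∀ i, C.proj w i = g • C.proj v i) : v = w := by
  by_contra hne
  obtain ⟨i, h1, h2⟩ := C.exists_proj_ne_ne v (C.dir v w) (g⁻¹ • C.dir w v)
  rcases C.proj_or_proj hne i with h3 | h3
  · exact h1 h3
  · apply h2
    rw [eq_inv_smul_iff, ← h, h3]

end Directions

/-- Two stable curves are isomorphic if the families of projections of the marked points to their
components are the same up to projective transformations. -/
theorem iso_of_proj {n : ℕ} {C D : StableCurve n}
    (hCD : ∀ v, ∃ w, ∃ g : Aut2, ∀ i, D.proj w i = g • C.proj v i)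
    (hDC : ∀ w, ∃ v, ∃ g : Aut2, ∀ i, C.proj v i = g • D.proj w i) : Nonempty (Iso C D) := by
  choose f g hfg using hCD
  choose f' g' hfg' using hDC
  have h1 : ∀ v, f' (f v) = v := fun v =>
    (C.eq_of_proj_smul (g' (f v) * g v) fun i => by rw [hfg', hfg, mul_smul]).symm
  have h2 : ∀ w, f (f' w) = w := fun w =>
    (D.eq_of_proj_smul (g (f' w) * g' w) fun i => by rw [hfg, hfg', mul_smul]).symm
  have hf : Function.Injective f := Function.LeftInverse.injective h1
  have hs : Function.Surjective f := Function.RightInverse.surjective h2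
  -- The dichotomy for `v, w` in `C`, moved to `D` by `g`, pins down the directions in `D`.
  -- Adjacency, nodes and marked points then follow, being expressed by directions and projections.
  have hdir : ∀ v w, v ≠ w → D.dir (f v) (f w) = g v • C.dir v w := fun v w h =>
    D.dir_eq_of_forall_proj (y := g w • C.dir w v) (fun h' => h (hf h')) fun i => by
      rw [hfg, hfg, smul_left_cancel_iff, smul_left_cancel_iff]
      exact C.proj_or_proj h i
  have hadj : ∀ v w, D.graph.Adj (f v) (f w) ↔ C.graph.Adj v w := by
    intro v w
    by_cases h : v = w
    · subst h
      simp
    · rw [D.adj_iff_dir (fun h' => h (hf h')), C.adj_iff_dir h, hs.forall]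
      refine forall_congr' fun u => ?_
      rw [hf.ne_iff, hf.ne_iff]
      refine forall_congr' fun huv => forall_congr' fun huw => ?_
      rw [hdir u v huv, hdir u w huw, smul_left_cancel_iff]
  have hcomp : ∀ i, D.comp i = f (C.comp i) := by
    intro i
    rw [D.comp_eq_iff, hs.forall]
    intro u hu
    have hu' : u ≠ C.comp i := fun h => hu (congrArg f h)
    exact (hfg u i).trans (((C.comp_eq_iff i _).1 rfl u hu').symm ▸ (hdir u _ hu').symm)
  exact ⟨{
    toEquiv := ⟨f, f', h1, h2⟩
    adj_iff := hadj
    aut := g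
    node_eq := fun v w h => by
      have h3 := hdir v w h.ne
      rwa [dir, dir, C.next_of_adj h, D.next_of_adj ((hadj v w).2 h)] at h3
    comp_eq := hcomp
    mark_eq := fun i => by rw [← D.proj_comp, ← C.proj_comp, hcomp, hfg] }⟩

end StableCurve

/-! ### Homogeneous coordinates and brackets -/

lemma mk_eq_mk_of_cross {ι : Type*} {v w : ι → ℂ} (hv : v ≠ 0) (hw : w ≠ 0)
    (h : ∀ i j, v i * w j = v j * w i) : Projectivization.mk ℂ v hv = Projectivization.mk ℂ w hw := by
  obtain ⟨i, hi⟩ := Function.ne_iff.1 hw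
  rw [Projectivization.mk_eq_mk_iff']
  refine ⟨v i / w i, ?_⟩
  ext j
  have hi' : w i ≠ 0 := hi
  simp only [Pi.smul_apply, smul_eq_mul]
  rw [div_mul_eq_mul_div, div_eq_iff hi', h]

lemma bracket_self (x : P1) : bracket x x = 0 := (bracket_eq_zero_iff x x).2 rfl

lemma bracket_ne_zero {x y : P1} (h : x ≠ y) : bracket x y ≠ 0 :=
  (bracket_eq_zero_iff x y).not.2 h

lemma bracket_swap (x y : P1) : bracket y x = -bracket x y := by
  unfold bracket
  ring

/-! ### Cross-ratios -/

/-- The points `p i`, `p j`, `p k`, `p l` have the same cross-ratio as `q i`, `q j`, `q k`, `q l`,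
unless one of the two cross-ratios is undefined. -/
def CrossRatioEq {ι : Type*} (p q : ι → P1) (i j k l : ι) : Prop :=
  bracket (p i) (p j) * bracket (p k) (p l) * (bracket (q i) (q k) * bracket (q j) (q l)) =
    bracket (p i) (p k) * bracket (p j) (p l) * (bracket (q i) (q j) * bracket (q k) (q l))

namespace CrossRatioEq

variable {ι : Type*} {p q r : ι → P1} {i j k l : ι}

lemma refl (p : ι → P1) (i j k l : ι) : CrossRatioEq p p i j k l := by
  unfold CrossRatioEq
  ring

lemma swap₁₂ (h : CrossRatioEq p q i j k l) : CrossRatioEq p q j i k l := by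
  unfold CrossRatioEq bracket at *
  linear_combination -h

lemma swap₂₃ (h : CrossRatioEq p q i j k l) : CrossRatioEq p q i k j l := by
  unfold CrossRatioEq at *
  linear_combination -h

lemma swap₃₄ (h : CrossRatioEq p q i j k l) : CrossRatioEq p q i j l k := by
  unfold CrossRatioEq bracket at *
  linear_combination -h

/-- Equality of cross-ratios is transitive if the cross-ratio in the middle is defined. -/
lemma trans (h₁ : CrossRatioEq p q i j k l) (h₂ : CrossRatioEq q r i j k l)
    (hq : bracket (q i) (q j) * bracket (q k) (q l) ≠ 0 ∨
      bracket (q i) (q k) * bracket (q j) (q l) ≠ 0) : CrossRatioEq p r i j k l := by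
  unfold CrossRatioEq at *
  rcases hq with hq | hq
  · apply mul_left_cancel₀ hq
    linear_combination (bracket (r i) (r j) * bracket (r k) (r l)) * h₁ +
      (bracket (p i) (p j) * bracket (p k) (p l)) * h₂
  · apply mul_left_cancel₀ hq
    linear_combination (bracket (r i) (r k) * bracket (r j) (r l)) * h₁ +
      (bracket (p i) (p k) * bracket (p j) (p l)) * h₂

/-- Two families, of which one or the other is constantly `x` or `y` at each index, have the same
cross-ratios. -/
lemma of_or {x y : P1} (h : ∀ i, p i = x ∨ q i = y) (i j k l : ι) : CrossRatioEq p q i j k l := by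
  unfold CrossRatioEq
  -- If one family is constant on three of the four indices, both sides vanish. In a two-two split,
  -- either both sides vanish or they agree by antisymmetry of the bracket.
  rcases h i with hi | hi <;> rcases h j with hj | hj <;> rcases h k with hk | hk <;>
    rcases h l with hl | hl <;> rw [hi, hj, hk, hl] <;> unfold bracket <;> ring

end CrossRatioEq

/-- Adjacent transpositions preserve the relation and generate all permutations. The table lists the
first two indices; the order of the other two is adjusted by `swap₃₄`. -/
lemma crossRatioEq_of_perm {p q : Fin 5 → P1} (h : CrossRatioEq p q 0 1 2 3) (i j k l : Fin 4)
    (hij : i ≠ j) (hik : i ≠ k) (hil : i ≠ l) (hjk : j ≠ k) (hjl : j ≠ l) (hkl : k ≠ l) :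
    CrossRatioEq p q i.castSucc j.castSucc k.castSucc l.castSucc := by
  have h1 : ∀ {i j k l}, CrossRatioEq p q i j k l → CrossRatioEq p q i k l j :=
    fun h => h.swap₂₃.swap₃₄
  have h2 : ∀ {i j k l}, CrossRatioEq p q i j k l → CrossRatioEq p q j k l i :=
    fun h => h.swap₁₂.swap₂₃.swap₃₄
  have key : ∀ i : Fin 4, ∀ j : Fin 4, i ≠ j → ∃ k l : Fin 4, i ≠ k ∧ i ≠ l ∧ j ≠ k ∧ j ≠ l ∧
      k ≠ l ∧ (∀ m, m = i ∨ m = j ∨ m = k ∨ m = l) ∧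
      CrossRatioEq p q i.castSucc j.castSucc k.castSucc l.castSucc := by
    intro i j hij
    fin_cases i <;> fin_cases j
    · exact absurd rfl hij
    · exact ⟨2, 3, by decide, by decide, by decide, by decide, by decide, by decide, h⟩
    · exact ⟨1, 3, by decide, by decide, by decide, by decide, by decide, by decide, h.swap₂₃⟩
    · exact ⟨1, 2, by decide, by decide, by decide, by decide, by decide, by decide, h1 (h1 h)⟩
    · exact ⟨2, 3, by decide, by decide, by decide, by decide, by decide, by decide, h.swap₁₂⟩
    · exact absurd rfl hij
    · exact ⟨0, 3, by decide, by decide, by decide, by decide, by decide, by decide,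
        h.swap₁₂.swap₂₃⟩
    · exact ⟨0, 2, by decide, by decide, by decide, by decide, by decide, by decide,
        h1 (h1 h.swap₁₂)⟩
    · exact ⟨1, 3, by decide, by decide, by decide, by decide, by decide, by decide,
        h.swap₂₃.swap₁₂⟩
    · exact ⟨0, 3, by decide, by decide, by decide, by decide, by decide, by decide,
        h.swap₁₂.swap₂₃.swap₁₂⟩
    · exact absurd rfl hij
    · exact ⟨0, 1, by decide, by decide, by decide, by decide, by decide, by decide, h2 (h2 h)⟩
    · exact ⟨1, 2, by decide, by decide, by decide, by decide, by decide, by decide,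
        (h1 (h1 h)).swap₁₂⟩
    · exact ⟨0, 2, by decide, by decide, by decide, by decide, by decide, by decide,
        (h1 (h1 h.swap₁₂)).swap₁₂⟩
    · exact ⟨0, 1, by decide, by decide, by decide, by decide, by decide, by decide,
        (h2 (h2 h)).swap₁₂⟩
    · exact absurd rfl hij
  obtain ⟨k', l', -, -, -, -, -, hall, hc⟩ := key i j hij
  rcases ((hall k).resolve_left hik.symm).resolve_left hjk.symm with rfl | rfl <;>
    rcases ((hall l).resolve_left hil.symm).resolve_left hjl.symm with rfl | rfl
  · exact absurd rfl hkl
  · exact hc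
  · exact hc.swap₃₄
  · exact absurd rfl hkl

/-- Families of points of `P1` with the same cross-ratios are projectively equivalent. -/
theorem exists_aut_of_crossRatioEq {ι : Type*} {p q : ι → P1} {i j m : ι}
    (hp₁ : p i ≠ p j) (hp₂ : p i ≠ p m) (hp₃ : p j ≠ p m)
    (hq₁ : q i ≠ q j) (hq₂ : q i ≠ q m) (hq₃ : q j ≠ q m)
    (h : ∀ k, CrossRatioEq p q k i j m) : ∃ g : Aut2, ∀ k, q k = g • p k := by
  -- The transformation taking `r i`, `r j`, `r m` to `[0:1]`, `[1:0]`, `[1:1]`. The ratio of the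
  -- two coordinates of the image of `r k` is the cross-ratio of `k, i, j, m`, so the normalized
  -- families of `p` and `q` coincide.
  have key : ∀ r : ι → P1, r i ≠ r j → r i ≠ r m → r j ≠ r m → ∃ L : Aut2, ∀ x : P1,
      L x.rep = ![bracket x (r i) * bracket (r j) (r m), bracket x (r j) * bracket (r i) (r m)] := by
    intro r h₁ h₂ h₃
    let M : Matrix (Fin 2) (Fin 2) ℂ :=
      !![(r i).rep 1 * bracket (r j) (r m), -(r i).rep 0 * bracket (r j) (r m);
        (r j).rep 1 * bracket (r i) (r m), -(r j).rep 0 * bracket (r i) (r m)]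
    have hM : LinearMap.det (Matrix.toLin' M) ≠ 0 := by
      rw [LinearMap.det_toLin', Matrix.det_fin_two]
      have : M 0 0 * M 1 1 - M 0 1 * M 1 0 =
          bracket (r i) (r j) * bracket (r i) (r m) * bracket (r j) (r m) := by
        simp only [M, Matrix.of_apply, Matrix.cons_val', Matrix.cons_val_zero,
          Matrix.cons_val_one, Matrix.cons_val_fin_one]
        unfold bracket
        ring
      rw [this]
      exact mul_ne_zero (mul_ne_zero (bracket_ne_zero h₁) (bracket_ne_zero h₂)) (bracket_ne_zero h₃)
    refine ⟨LinearMap.equivOfDetNeZero _ hM, fun x => ?_⟩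
    change Matrix.toLin' M x.rep = _
    ext a
    fin_cases a <;> simp [M, Matrix.toLin'_apply, Matrix.mulVec, dotProduct, Fin.sum_univ_two] <;>
      unfold bracket <;> ring
  obtain ⟨A, hA⟩ := key p hp₁ hp₂ hp₃
  obtain ⟨B, hB⟩ := key q hq₁ hq₂ hq₃
  refine ⟨B⁻¹ * A, fun k => ?_⟩
  rw [mul_smul, eq_inv_smul_iff]
  have hs : ∀ (g : Aut2) (x : P1),
      g • x = Projectivization.mk ℂ (g x.rep) (by simpa using x.rep_nonzero) := by
    intro g x
    conv_lhs => rw [← x.mk_rep, Projectivization.smul_mk]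
    rfl
  rw [hs, hs]
  apply mk_eq_mk_of_cross
  rw [hA, hB]
  have hk := h k
  unfold CrossRatioEq at hk
  intro a b
  fin_cases a <;> fin_cases b <;> simp
  · linear_combination -hk
  · linear_combination hk

namespace StableCurve

/-- The cross-ratio of four marked points is independent of the component of a stable curve on
which it is computed. -/
lemma crossRatioEq_proj {n : ℕ} (C : StableCurve n) (v w : C.V) (i j k l : Fin n) :
    CrossRatioEq (C.proj v) (C.proj w) i j k l := by
  by_cases h : v = w
  · subst h
    exact .refl _ _ _ _ _
  · exact .of_or (C.proj_or_proj h) i j k l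

/-! ### The projections of the stabilization -/

section Forget

variable {k : ℕ}

/-- A walk in the contracted graph lifts to `C` by sending each new edge through the contracted
component. The lift still avoids `w`, which is not that component, so directions do not change. -/
lemma contract_node_next (C : StableCurve (k + 4))
    (h : ¬ 4 ≤ C.special (C.comp (Fin.last (k + 3)))) (w c : (C.contract h).V) (hwc : w ≠ c) :
    (C.contract h).dir w c = C.dir w.1 c.1 := by
  classical
  obtain ⟨p, -, hp⟩ := (C.contract h).exists_walk_next hwc
  have lift : ∀ (a b : (C.contract h).V) (q : (C.contract h).graph.Walk a b), w ∉ q.support →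
      ∃ q' : C.graph.Walk a.1 b.1, w.1 ∉ q'.support := by
    intro a b q
    induction q with
    | nil =>
      intro hw
      refine ⟨.nil, ?_⟩
      simp only [SimpleGraph.Walk.support_nil, List.mem_singleton] at hw ⊢
      exact fun h' => hw (Subtype.ext h')
    | @cons a a' b hadj q ih =>
      intro hw
      rw [SimpleGraph.Walk.support_cons, List.mem_cons, not_or] at hw
      obtain ⟨q', hq'⟩ := ih hw.2
      have hwa : w.1 ≠ a.1 := fun h' => hw.1 (Subtype.ext h')
      rcases hadj with hadj | ⟨h1, h2, -⟩
      · exact ⟨.cons hadj q', by simp [hwa, hq']⟩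
      · exact ⟨.cons h1.symm (.cons h2 q'), by simp [hwa, hq', w.2]⟩
  obtain ⟨p', hp'⟩ := lift _ _ p hp
  have hadj := (C.contract h).next_adj hwc
  change (if C.graph.Adj w.1 ((C.contract h).next w c).1 then
    C.node w.1 ((C.contract h).next w c).1 else C.node w.1 (C.comp (Fin.last (k + 3)))) = _
  by_cases h1 : C.graph.Adj w.1 ((C.contract h).next w c).1
  · rw [if_pos h1, dir, C.next_eq_of_walk h1 p' hp']
  · rw [if_neg h1]
    obtain ⟨h2, h3, -⟩ := Or.resolve_left hadj h1
    rw [dir, C.next_eq_of_walk h2.symm (.cons h3 p') (by simp [hp', w.2])]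

/-- A marked point on the contracted component moves to the node of the neighbour, which is the
point to which the neighbour projected it before. From elsewhere, the neighbour and the contracted
component lie in the same direction. -/
lemma contract_proj (C : StableCurve (k + 4))
    (h : ¬ 4 ≤ C.special (C.comp (Fin.last (k + 3)))) (w : (C.contract h).V) (i : Fin (k + 3)) :
    (C.contract h).proj w i = C.proj w.1 i.castSucc := by
  classical
  have hw : w.1 ≠ C.comp (Fin.last (k + 3)) := w.2
  have hnb := C.adj_neighbor h
  by_cases hi : C.comp i.castSucc = C.comp (Fin.last (k + 3))
  · have hc : (C.contract h).comp i = ⟨C.neighbor h, hnb.ne'⟩ := dif_pos hi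
    have hm : (C.contract h).mark i = C.node (C.neighbor h) (C.comp (Fin.last (k + 3))) := if_pos hi
    rw [C.proj_eq_dir (by rw [hi]; exact hw.symm), hi]
    by_cases hwn : (C.contract h).comp i = w
    · subst hwn
      rw [proj_comp, hm, hc, dir, C.next_of_adj hnb.symm]
    · have hwn' : w.1 ≠ C.neighbor h := fun h' => hwn (hc.trans (Subtype.ext h'.symm))
      rw [proj_eq_dir _ hwn, contract_node_next _ _ _ _ (Ne.symm hwn), hc]
      exact (C.dir_eq_dir_iff hwn' hw).2 (C.next_eq_next_of_adj hnb.symm hwn' hw)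
  · have hc : (C.contract h).comp i = ⟨C.comp i.castSucc, hi⟩ := dif_neg hi
    have hm : (C.contract h).mark i = C.mark i.castSucc := if_neg hi
    by_cases hwn : (C.contract h).comp i = w
    · subst hwn
      rw [proj_comp, hm, hc, proj_comp]
    · have hwn' : C.comp i.castSucc ≠ w.1 := fun h' => hwn (hc.trans (Subtype.ext h'))
      rw [proj_eq_dir _ hwn, contract_node_next _ _ _ _ (Ne.symm hwn), hc, C.proj_eq_dir hwn']

/-- Lets the Kapranov coordinates of the stabilization be computed on `C` itself. -/
lemma exists_forget_proj (C : StableCurve (k + 4)) (w : C.forget.V) :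
    ∃ v, ∀ i, C.forget.proj w i = C.proj v i.castSucc := by
  classical
  by_cases h : 4 ≤ C.special (C.comp (Fin.last (k + 3)))
  · have hf : C.forget = C.dropMark h := dif_pos h
    revert w
    rw [hf]
    exact fun w => ⟨w, fun i => rfl⟩
  · have hf : C.forget = C.contract h := dif_neg h
    revert w
    rw [hf]
    exact fun w => ⟨w.1, fun i => C.contract_proj h w i⟩

end Forget

/-! ### Kapranov coordinates and cross-ratios with the last marked point -/

section Kapranov

variable {k : ℕ}

lemma bracket_proj_last_ne_zero (C : StableCurve (k + 3)) (i : Fin (k + 2)) :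
    bracket (C.proj (C.comp (Fin.last (k + 2))) (Fin.last (k + 2)))
      (C.proj (C.comp (Fin.last (k + 2))) i.castSucc) ≠ 0 :=
  bracket_ne_zero (C.proj_ne_last i)

lemma kapranovVec_mul (C : StableCurve (k + 3)) (j : Fin (k + 1)) :
    C.kapranovVec j * bracket (C.proj (C.comp (Fin.last (k + 2))) (Fin.last (k + 2)))
      (C.proj (C.comp (Fin.last (k + 2))) j.succ.castSucc) =
    bracket (C.proj (C.comp (Fin.last (k + 2))) 0)
      (C.proj (C.comp (Fin.last (k + 2))) j.succ.castSucc) :=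
  div_mul_cancel₀ _ (C.bracket_proj_last_ne_zero _)

/-- The Kapranov map determines the component of the last marked point. -/
lemma crossRatioEq_of_kapranov_eq {C D : StableCurve (k + 3)} (h : C.kapranov = D.kapranov)
    (i j l : Fin (k + 2)) :
    CrossRatioEq (C.proj (C.comp (Fin.last (k + 2)))) (D.proj (D.comp (Fin.last (k + 2))))
      i.castSucc j.castSucc l.castSucc (Fin.last (k + 2)) := by
  obtain ⟨c, hc⟩ := (Projectivization.mk_eq_mk_iff' ℂ _ _ _ _).1 h
  have hc0 : c ≠ 0 := by
    rintro rfl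
    exact C.kapranovVec_ne_zero (by rw [← hc, zero_smul])
  have hEC := C.bracket_proj_last_ne_zero
  have hED := D.bracket_proj_last_ne_zero
  have hC := C.kapranovVec_mul
  have hD := D.kapranovVec_mul
  set p := C.proj (C.comp (Fin.last (k + 2)))
  set q := D.proj (D.comp (Fin.last (k + 2)))
  -- Let `tᵢ` be the quotient of the brackets of `p 0` and of the last point with `p i`: an affine
  -- coordinate with `p 0` at `0` and the last point at infinity. Equal Kapranov points have
  -- proportional `t`; the index `0` only adds `t = 0`.
  have hA : ∀ i : Fin (k + 2), bracket (p 0) (p i.castSucc) *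
      bracket (q (Fin.last (k + 2))) (q i.castSucc) =
        c * (bracket (q 0) (q i.castSucc) * bracket (p (Fin.last (k + 2))) (p i.castSucc)) := by
    intro i
    induction i using Fin.cases with
    | zero => simp [bracket_self]
    | succ j =>
      rw [← hC, ← hD, ← hc, Pi.smul_apply, smul_eq_mul]
      ring
  -- By the Plücker relation this is the proportionality of the differences `tᵢ - tⱼ`, with
  -- denominators cleared. A cross-ratio with the last point is a quotient of two such differences,
  -- so the factor `c` drops out.
  have hB : ∀ i j : Fin (k + 2), bracket (p i.castSucc) (p j.castSucc) *
      bracket (p 0) (p (Fin.last (k + 2))) *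
      (bracket (q (Fin.last (k + 2))) (q i.castSucc) * bracket (q (Fin.last (k + 2))) (q j.castSucc)) =
      c * (bracket (q i.castSucc) (q j.castSucc) * bracket (q 0) (q (Fin.last (k + 2)))) *
      (bracket (p (Fin.last (k + 2))) (p i.castSucc) *
        bracket (p (Fin.last (k + 2))) (p j.castSucc)) := by
    have plucker : ∀ r : Fin (k + 3) → P1, ∀ i j : Fin (k + 2),
        bracket (r i.castSucc) (r j.castSucc) * bracket (r 0) (r (Fin.last (k + 2))) =
        bracket (r 0) (r j.castSucc) * bracket (r (Fin.last (k + 2))) (r i.castSucc) * (-1) +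
        bracket (r 0) (r i.castSucc) * bracket (r (Fin.last (k + 2))) (r j.castSucc) := by
      intro r i j
      unfold bracket
      ring
    intro i j
    rw [plucker p, plucker q]
    linear_combination (-bracket (q (Fin.last (k + 2))) (q i.castSucc) *
      bracket (p (Fin.last (k + 2))) (p i.castSucc)) * hA j +
      (bracket (q (Fin.last (k + 2))) (q j.castSucc) *
      bracket (p (Fin.last (k + 2))) (p j.castSucc)) * hA i
  have hp0 : bracket (p 0) (p (Fin.last (k + 2))) ≠ 0 := by
    rw [bracket_swap]
    exact neg_ne_zero.2 (hEC 0)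
  have hq0 : bracket (q 0) (q (Fin.last (k + 2))) ≠ 0 := by
    rw [bracket_swap]
    exact neg_ne_zero.2 (hED 0)
  unfold CrossRatioEq
  rw [bracket_swap (p (Fin.last (k + 2))) (p l.castSucc),
    bracket_swap (q (Fin.last (k + 2))) (q l.castSucc),
    bracket_swap (p (Fin.last (k + 2))) (p j.castSucc),
    bracket_swap (q (Fin.last (k + 2))) (q j.castSucc)]
  have hne := mul_ne_zero (mul_ne_zero (mul_ne_zero hp0 hq0) (mul_ne_zero (hEC i) (hED i))) hc0
  apply mul_left_cancel₀ hne
  linear_combination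
    (c * bracket (q i.castSucc) (q l.castSucc) * bracket (q 0) (q (Fin.last (k + 2))) *
      bracket (p (Fin.last (k + 2))) (p i.castSucc) *
      bracket (p (Fin.last (k + 2))) (p l.castSucc)) * hB i j -
    (c * bracket (q i.castSucc) (q j.castSucc) * bracket (q 0) (q (Fin.last (k + 2))) *
      bracket (p (Fin.last (k + 2))) (p i.castSucc) *
      bracket (p (Fin.last (k + 2))) (p j.castSucc)) * hB i l

end Kapranov
end StableCurve
namespace StableCurve

/-! ### Five marked points -/

/-- The Kapranov map after forgetting the fifth point is the cross-ratio of the first four. -/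
lemma forget_kapranovVec_mul (C : StableCurve (1 + 4)) (v : C.V) :
    C.forget.kapranovVec (k := 1) 0 *
        (bracket (C.proj v 0) (C.proj v 2) * bracket (C.proj v 1) (C.proj v 3)) =
      C.forget.kapranovVec (k := 1) 1 *
        (bracket (C.proj v 0) (C.proj v 1) * bracket (C.proj v 2) (C.proj v 3)) := by
  have h0 := C.forget.kapranovVec_mul (k := 1) 0
  have h1 := C.forget.kapranovVec_mul (k := 1) 1
  have hne1 := C.forget.bracket_proj_last_ne_zero (k := 1) 1
  have hne2 := C.forget.bracket_proj_last_ne_zero (k := 1) 2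
  have hne := C.forget.kapranovVec_ne_zero (k := 1)
  obtain ⟨u, hu⟩ := C.exists_forget_proj (C.forget.comp (Fin.last (1 + 2)))
  rw [hu, hu, hu] at h0 h1
  rw [hu, hu] at hne1 hne2
  change _ * bracket (C.proj u 3) (C.proj u 1) = bracket (C.proj u 0) (C.proj u 1) at h0
  change _ * bracket (C.proj u 3) (C.proj u 2) = bracket (C.proj u 0) (C.proj u 2) at h1
  change bracket (C.proj u 3) (C.proj u 1) ≠ 0 at hne1
  change bracket (C.proj u 3) (C.proj u 2) ≠ 0 at hne2
  have hcr := C.crossRatioEq_proj u v 0 1 2 3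
  unfold CrossRatioEq at hcr
  rw [bracket_swap (C.proj u 3) (C.proj u 1), bracket_swap (C.proj u 3) (C.proj u 2)] at hcr
  -- The Kapranov vector is nonzero, so one of the brackets of `0` with `1` and with `2` on `u` is
  -- nonzero. That one is cancelled after the cross-ratio is carried from `u` to `v`.
  by_cases hx : bracket (C.proj u 0) (C.proj u 1) = 0
  · have hy : bracket (C.proj u 0) (C.proj u 2) ≠ 0 := by
      intro hy
      apply hne
      rw [hx] at h0
      rw [hy] at h1
      ext j
      fin_cases j
      · exact (mul_eq_zero.1 h0).resolve_right hne1
      · exact (mul_eq_zero.1 h1).resolve_right hne2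
    apply mul_left_cancel₀ (mul_ne_zero hy hne1)
    linear_combination (-C.forget.kapranovVec (k := 1) 1) * hcr + (bracket (C.proj u 0) (C.proj u 2) *
      (bracket (C.proj v 0) (C.proj v 2) * bracket (C.proj v 1) (C.proj v 3))) * h0 -
      (bracket (C.proj u 0) (C.proj u 1) *
      (bracket (C.proj v 0) (C.proj v 2) * bracket (C.proj v 1) (C.proj v 3))) * h1
  · apply mul_left_cancel₀ (mul_ne_zero hx hne2)
    linear_combination (-C.forget.kapranovVec (k := 1) 0) * hcr + (bracket (C.proj u 0) (C.proj u 2) *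
      (bracket (C.proj v 0) (C.proj v 1) * bracket (C.proj v 2) (C.proj v 3))) * h0 -
      (bracket (C.proj u 0) (C.proj u 1) *
      (bracket (C.proj v 0) (C.proj v 1) * bracket (C.proj v 2) (C.proj v 3))) * h1

/-- On the component of the fifth point, `b` gives affine coordinates of the second to fourth
points, with the first at `0` and the fifth at infinity. The Plücker relation turns the remaining
brackets into differences of the `b`'s, and the equation becomes the cross-ratio formula for `a`. -/
lemma equation_kapranovVec (C : StableCurve (1 + 4)) :
    C.forget.kapranovVec (k := 1) 0 * C.kapranovVec (k := 2) 1 *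
        (C.kapranovVec (k := 2) 0 - C.kapranovVec (k := 2) 2) =
      C.forget.kapranovVec (k := 1) 1 * C.kapranovVec (k := 2) 0 *
        (C.kapranovVec (k := 2) 1 - C.kapranovVec (k := 2) 2) := by
  have h0 := C.kapranovVec_mul (k := 2) 0
  have h1 := C.kapranovVec_mul (k := 2) 1
  have h2 := C.kapranovVec_mul (k := 2) 2
  have e0 := C.bracket_proj_last_ne_zero (k := 2) 1
  have e1 := C.bracket_proj_last_ne_zero (k := 2) 2
  have e2 := C.bracket_proj_last_ne_zero (k := 2) 3
  have ha := C.forget_kapranovVec_mul (C.comp (Fin.last (2 + 2)))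
  set p := C.proj (C.comp (Fin.last (2 + 2)))
  change _ * bracket (p 4) (p 1) = bracket (p 0) (p 1) at h0
  change _ * bracket (p 4) (p 2) = bracket (p 0) (p 2) at h1
  change _ * bracket (p 4) (p 3) = bracket (p 0) (p 3) at h2
  change bracket (p 4) (p 1) ≠ 0 at e0
  change bracket (p 4) (p 2) ≠ 0 at e1
  change bracket (p 4) (p 3) ≠ 0 at e2
  have plucker : ∀ i : Fin 5, bracket (p 0) (p i) * bracket (p 4) (p 3) -
      bracket (p 0) (p 3) * bracket (p 4) (p i) = bracket (p 0) (p 4) * bracket (p i) (p 3) := by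
    intro i
    unfold bracket
    ring
  have p1 := plucker 1
  have p2 := plucker 2
  rw [← h0, ← h2] at p1
  rw [← h1, ← h2] at p2
  rw [← h0, ← h1] at ha
  apply mul_left_cancel₀ (mul_ne_zero (mul_ne_zero e0 e1) e2)
  linear_combination (C.forget.kapranovVec (k := 1) 0 * C.kapranovVec (k := 2) 1 *
    bracket (p 4) (p 2)) * p1 - (C.forget.kapranovVec (k := 1) 1 * C.kapranovVec (k := 2) 0 *
    bracket (p 4) (p 1)) * p2 + bracket (p 0) (p 4) * ha

/-! ### Injectivity -/

lemma crossRatioEq_of_forget_kapranov_eq {C D : StableCurve (1 + 4)}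
    (h : C.forget.kapranov (k := 1) = D.forget.kapranov (k := 1)) (v : C.V) (w : D.V) :
    CrossRatioEq (C.proj v) (D.proj w) 0 1 2 3 := by
  obtain ⟨c, hc⟩ := (Projectivization.mk_eq_mk_iff' ℂ _ _ _ _).1 h
  have hne := C.forget.kapranovVec_ne_zero (k := 1)
  have h1 := C.forget_kapranovVec_mul v
  have h2 := D.forget_kapranovVec_mul w
  have hc0 := congrFun hc 0
  have hc1 := congrFun hc 1
  rw [Pi.smul_apply, smul_eq_mul] at hc0 hc1
  unfold CrossRatioEq
  by_cases h0 : C.forget.kapranovVec (k := 1) 0 = 0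
  · have h0' : C.forget.kapranovVec (k := 1) 1 ≠ 0 := by
      intro h0'
      apply hne
      ext j
      fin_cases j <;> assumption
    apply mul_left_cancel₀ h0'
    linear_combination (-(bracket (D.proj w 0) (D.proj w 2) * bracket (D.proj w 1) (D.proj w 3))) *
      h1 + (bracket (C.proj v 0) (C.proj v 2) * bracket (C.proj v 1) (C.proj v 3) * c) * h2 -
      (bracket (C.proj v 0) (C.proj v 2) * bracket (C.proj v 1) (C.proj v 3) *
      (bracket (D.proj w 0) (D.proj w 2) * bracket (D.proj w 1) (D.proj w 3))) * hc0 +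
      (bracket (C.proj v 0) (C.proj v 2) * bracket (C.proj v 1) (C.proj v 3) *
      (bracket (D.proj w 0) (D.proj w 1) * bracket (D.proj w 2) (D.proj w 3))) * hc1
  · apply mul_left_cancel₀ h0
    linear_combination (-(bracket (D.proj w 0) (D.proj w 1) * bracket (D.proj w 2) (D.proj w 3))) *
      h1 + (bracket (C.proj v 0) (C.proj v 1) * bracket (C.proj v 2) (C.proj v 3) * c) * h2 -
      (bracket (C.proj v 0) (C.proj v 1) * bracket (C.proj v 2) (C.proj v 3) *
      (bracket (D.proj w 0) (D.proj w 2) * bracket (D.proj w 1) (D.proj w 3))) * hc0 +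
      (bracket (C.proj v 0) (C.proj v 1) * bracket (C.proj v 2) (C.proj v 3) *
      (bracket (D.proj w 0) (D.proj w 1) * bracket (D.proj w 2) (D.proj w 3))) * hc1

lemma eq_castSucc_of_proj_ne_last {n : ℕ} {C : StableCurve (n + 1)} {v : C.V} {i : Fin (n + 1)}
    (h : C.proj v i ≠ C.proj v (Fin.last n)) : ∃ j : Fin n, j.castSucc = i := by
  induction i using Fin.lastCases with
  | last => exact absurd rfl h
  | cast j => exact ⟨j, rfl⟩

/-- The Kapranov map determines which marked points have the same projection to the component of
the last marked point. -/
lemma proj_eq_of_kapranov_eq {k : ℕ} {C D : StableCurve (k + 3)} (h : C.kapranov = D.kapranov)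
    {i j : Fin (k + 2)}
    (hij : C.proj (C.comp (Fin.last (k + 2))) i.castSucc =
      C.proj (C.comp (Fin.last (k + 2))) j.castSucc) :
    D.proj (D.comp (Fin.last (k + 2))) i.castSucc =
      D.proj (D.comp (Fin.last (k + 2))) j.castSucc := by
  -- With `l` away from `i` and from the last point, the cross-ratio relation leaves the bracket of
  -- the `i`-th and `j`-th points on `D` as the only factor that can vanish.
  obtain ⟨l, h1, h2⟩ := C.exists_proj_ne_ne (C.comp (Fin.last (k + 2)))
    (C.proj (C.comp (Fin.last (k + 2))) i.castSucc)
    (C.proj (C.comp (Fin.last (k + 2))) (Fin.last (k + 2)))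
  obtain ⟨l, rfl⟩ := eq_castSucc_of_proj_ne_last h2
  have hcr := crossRatioEq_of_kapranov_eq h i j l
  unfold CrossRatioEq at hcr
  rw [← hij, bracket_self, zero_mul, zero_mul] at hcr
  have h3 := mul_ne_zero (bracket_ne_zero h1.symm) (bracket_ne_zero (C.proj_ne_last i).symm)
  have h4 := (mul_eq_zero.1 ((mul_eq_zero.1 hcr.symm).resolve_left h3)).resolve_right
    (bracket_ne_zero (D.proj_ne_last l).symm)
  exact (bracket_eq_zero_iff _ _).1 h4

/-- If the `i`-th marked point is separated by `v` from the last one, then so are only marked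
points with the same projection to the component of the last one. -/
lemma proj_eq_proj_last {n : ℕ} {C : StableCurve (n + 1)} {v : C.V} {i l : Fin (n + 1)}
    (hv : v ≠ C.comp (Fin.last n)) (hi : C.proj v i ≠ C.proj v (Fin.last n))
    (hl : C.proj (C.comp (Fin.last n)) l ≠ C.proj (C.comp (Fin.last n)) i) :
    C.proj v l = C.proj v (Fin.last n) := by
  have h1 := C.proj_eq_dir (i := Fin.last n) hv.symm
  rw [h1] at hi ⊢
  have h2 := (C.proj_or_proj hv i).resolve_left hi
  exact (C.proj_or_proj hv l).resolve_right (h2 ▸ hl)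

/-- Choose `i, j` which `v` separates from each other and from the fifth point, and take for `w` the
median of these three in `D`. By `exists_aut_of_crossRatioEq` it suffices to match the cross-ratios
of `k, i, j` and the fifth point, for every `k`. -/
lemma exists_proj_equiv {C D : StableCurve 5}
    (ha : C.forget.kapranov (k := 1) = D.forget.kapranov (k := 1))
    (hb : C.kapranov (k := 2) = D.kapranov (k := 2)) (v : C.V) :
    ∃ w, ∃ g : Aut2, ∀ i, D.proj w i = g • C.proj v i := by
  obtain ⟨i, hi, -⟩ := C.exists_proj_ne_ne v (C.proj v 4) (C.proj v 4)
  obtain ⟨j, hj, hji⟩ := C.exists_proj_ne_ne v (C.proj v 4) (C.proj v i)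
  obtain ⟨i, rfl⟩ := eq_castSucc_of_proj_ne_last (n := 4) hi
  obtain ⟨j, rfl⟩ := eq_castSucc_of_proj_ne_last (n := 4) hj
  have hij : i ≠ j := fun h => hji (by rw [h])
  obtain ⟨w, hw1, hw2, hw3⟩ := D.exists_median (i := i.castSucc) (j := j.castSucc) (k := 4)
    (fun h => hij (Fin.castSucc_injective _ h)) (Fin.castSucc_lt_last i).ne
    (Fin.castSucc_lt_last j).ne
  refine ⟨w, exists_aut_of_crossRatioEq hji.symm hi hj hw1 hw2 hw3 fun k => ?_⟩
  induction k using Fin.lastCases with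
  | last =>
    unfold CrossRatioEq
    change bracket (C.proj v 4) _ * _ * (bracket (D.proj w 4) _ * _) =
      bracket (C.proj v 4) _ * _ * (bracket (D.proj w 4) _ * _)
    rw [bracket_swap (C.proj v 4) (C.proj v i.castSucc),
      bracket_swap (C.proj v 4) (C.proj v j.castSucc),
      bracket_swap (D.proj w 4) (D.proj w i.castSucc),
      bracket_swap (D.proj w 4) (D.proj w j.castSucc)]
    ring
  | cast k =>
  by_cases hki : k = i
  · simp [CrossRatioEq, hki, bracket_self]
  by_cases hkj : k = j
  · simp [CrossRatioEq, hkj, bracket_self]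
  let r := C.comp (Fin.last 4)
  let s := D.comp (Fin.last 4)
  -- If the component `r` of the fifth point confuses `k, i, j`, the cross-ratio is undefined there.
  -- The remaining marked point `l` is then confused with the fifth one by `v` and by `w`, so the
  -- cross-ratio is that of the first four points, known from `a`.
  by_cases hdeg : C.proj r k.castSucc = C.proj r i.castSucc ∧
      C.proj r k.castSucc = C.proj r j.castSucc
  · obtain ⟨h1, h2⟩ := hdeg
    have h1' : D.proj s k.castSucc = D.proj s i.castSucc := proj_eq_of_kapranov_eq (k := 2) hb h1
    have h2' : D.proj s k.castSucc = D.proj s j.castSucc := proj_eq_of_kapranov_eq (k := 2) hb h2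
    obtain ⟨l, hl, hl4⟩ := C.exists_proj_ne_ne r (C.proj r i.castSucc) (C.proj r (Fin.last 4))
    obtain ⟨l, rfl⟩ := eq_castSucc_of_proj_ne_last hl4
    have hl' : D.proj s l.castSucc ≠ D.proj s i.castSucc := fun h =>
      hl (proj_eq_of_kapranov_eq (k := 2) hb.symm h)
    have hvr : v ≠ C.comp (Fin.last 4) := by
      intro h
      apply hji
      rw [h]
      exact h2.symm.trans h1
    have hws : w ≠ D.comp (Fin.last 4) := by
      intro h
      apply hw1
      rw [h]
      exact h1'.symm.trans h2'
    have hl5 : C.proj v l.castSucc = C.proj v 4 := proj_eq_proj_last hvr hi hl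
    have hl5' : D.proj w l.castSucc = D.proj w 4 := proj_eq_proj_last hws hw2 hl'
    have hli : i ≠ l := fun h => hl (by rw [h])
    have hlj : j ≠ l := fun h => hl (by rw [← h]; exact h2.symm.trans h1)
    have hlk : k ≠ l := fun h => hl (by rw [← h]; exact h1)
    have := crossRatioEq_of_perm (crossRatioEq_of_forget_kapranov_eq ha v w) k i j l hki hkj hlk
      hij hli hlj
    unfold CrossRatioEq at this ⊢
    rwa [hl5, hl5'] at this
  · have hdeg' : ¬ (D.proj s k.castSucc = D.proj s i.castSucc ∧
        D.proj s k.castSucc = D.proj s j.castSucc) := fun h =>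
      hdeg ⟨proj_eq_of_kapranov_eq (k := 2) hb.symm h.1, proj_eq_of_kapranov_eq (k := 2) hb.symm h.2⟩
    -- The fifth point is alone at its place on its own component, so the cross-ratio is defined
    -- there unless `k, i, j` all coincide. This is the nondegeneracy needed to chain from `v`
    -- through `r` and `s` to `w`.
    have key : ∀ E : StableCurve 5, ¬ (E.proj (E.comp (Fin.last 4)) k.castSucc =
        E.proj (E.comp (Fin.last 4)) i.castSucc ∧ E.proj (E.comp (Fin.last 4)) k.castSucc =
        E.proj (E.comp (Fin.last 4)) j.castSucc) →
        bracket (E.proj (E.comp (Fin.last 4)) k.castSucc)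
            (E.proj (E.comp (Fin.last 4)) i.castSucc) *
          bracket (E.proj (E.comp (Fin.last 4)) j.castSucc) (E.proj (E.comp (Fin.last 4)) 4) ≠ 0 ∨
        bracket (E.proj (E.comp (Fin.last 4)) k.castSucc)
            (E.proj (E.comp (Fin.last 4)) j.castSucc) *
          bracket (E.proj (E.comp (Fin.last 4)) i.castSucc) (E.proj (E.comp (Fin.last 4)) 4) ≠ 0 := by
      intro E hE
      by_cases h : E.proj (E.comp (Fin.last 4)) k.castSucc = E.proj (E.comp (Fin.last 4)) i.castSucc
      · exact Or.inr (mul_ne_zero (bracket_ne_zero fun h' => hE ⟨h, h'⟩)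
          (bracket_ne_zero (E.proj_ne_last (k := 2) i).symm))
      · exact Or.inl (mul_ne_zero (bracket_ne_zero h)
          (bracket_ne_zero (E.proj_ne_last (k := 2) j).symm))
    exact ((C.crossRatioEq_proj v r _ _ _ _).trans
      (crossRatioEq_of_kapranov_eq (k := 2) hb k i j) (key C hdeg)).trans
      (D.crossRatioEq_proj s w _ _ _ _) (key D hdeg')

end StableCurve

theorem phi_injective : Function.Injective phi := by
  intro x y
  induction x using Quotient.inductionOn with | _ C
  induction y using Quotient.inductionOn with | _ D
  intro h
  have ha : C.forget.kapranov (k := 1) = D.forget.kapranov (k := 1) := congrArg Prod.fst h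
  have hb : C.kapranov (k := 2) = D.kapranov (k := 2) := congrArg Prod.snd h
  exact Quotient.sound (StableCurve.iso_of_proj (StableCurve.exists_proj_equiv ha hb)
    (StableCurve.exists_proj_equiv ha.symm hb.symm))

/-! ### Points of the projective line -/

/-- The point of `P1` with the affine coordinate `z`. -/
noncomputable def affinePt (z : ℂ) : P1 := Projectivization.mk ℂ ![z, 1] fun h => one_ne_zero (congrFun h 1)

/-- The point of `P1` at infinity. -/
noncomputable def inftyPt : P1 := Projectivization.mk ℂ ![1, 0] fun h => one_ne_zero (congrFun h 0)

/-- The chosen representatives are multiples of `(z, 1)` and `(1, 0)` by unknown scalars `c z` and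
`d`. Keeping these explicit lets them cancel in ratios of brackets. -/
lemma exists_bracket_affinePt : ∃ (c : ℂ → ℂ) (d : ℂ), (∀ z, c z ≠ 0) ∧ d ≠ 0 ∧
    (∀ z w, bracket (affinePt z) (affinePt w) = c z * c w * (z - w)) ∧
    (∀ z, bracket inftyPt (affinePt z) = d * c z) ∧
    ∀ z, bracket (affinePt z) inftyPt = -(d * c z) := by
  have hc : ∀ z, ∃ c : ℂ, c ≠ 0 ∧ (affinePt z).rep = c • ![z, 1] := fun z => by
    obtain ⟨c, hc⟩ := Projectivization.exists_smul_eq_mk_rep ℂ ![z, 1]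
      fun h => one_ne_zero (congrFun h 1)
    exact ⟨c, c.ne_zero, hc.symm⟩
  obtain ⟨d, hd⟩ := Projectivization.exists_smul_eq_mk_rep ℂ (![1, 0] : Fin 2 → ℂ)
      fun h => one_ne_zero (congrFun h 0)
  choose c hc0 hc using hc
  have hd' : inftyPt.rep = (d : ℂ) • ![1, 0] := hd.symm
  refine ⟨c, d, hc0, d.ne_zero, fun z w => ?_, fun z => ?_, fun z => ?_⟩ <;> unfold bracket <;>
    simp [hc, hd'] <;> ring

lemma affinePt_injective : Function.Injective affinePt := by
  intro z w h
  obtain ⟨c, d, hc, -, h1, -⟩ := exists_bracket_affinePt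
  have h2 := h1 z w
  rw [h, bracket_self, eq_comm, mul_eq_zero] at h2
  exact sub_eq_zero.1 (h2.resolve_left (mul_ne_zero (hc z) (hc w)))

lemma affinePt_ne_inftyPt (z : ℂ) : affinePt z ≠ inftyPt := by
  intro h
  obtain ⟨c, d, hc, hd, -, h1, -⟩ := exists_bracket_affinePt
  have h2 := h1 z
  rw [h, bracket_self] at h2
  exact mul_ne_zero hd (hc z) h2.symm

lemma three_le_ncard_range {ι α : Type*} [Finite ι] {q : ι → α} (i j k : ι) (hij : q i ≠ q j)
    (hik : q i ≠ q k) (hjk : q j ≠ q k) : 3 ≤ (Set.range q).ncard := by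
  rw [← Set.ncard_eq_three.2 ⟨q i, q j, q k, hij, hik, hjk, rfl⟩]
  refine Set.ncard_le_ncard ?_ (Set.finite_range q)
  rintro _ (rfl | rfl | rfl) <;> exact Set.mem_range_self _

/-! ### Curves with a central component -/

section Star

variable {n : ℕ} (q : Fin n → P1)

/-- The points of `P1` that occur more than once in the family `q`. -/
abbrev MultiplePoint : Type := {x : P1 // ∃ i j, i ≠ j ∧ q i = x ∧ q j = x}

instance : Finite (MultiplePoint q) :=
  Finite.of_surjective (fun i : {i // ∃ j k, j ≠ k ∧ q j = q i ∧ q k = q i} =>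
      (⟨q i, i.2⟩ : MultiplePoint q)) (by
    rintro ⟨x, i, j, hij, hi, hj⟩
    exact ⟨⟨i, i, j, hij, rfl, hj.trans hi.symm⟩, Subtype.ext hi⟩)

open Classical in
/-- The stable curve with a central component on which the marked points project to the family
`q`: at each multiple point of `q` another component is attached, which carries the marked
points that project to the multiple point. -/
noncomputable def starCurve (hq : 3 ≤ (Set.range q).ncard) : StableCurve n where
  V := Option (MultiplePoint q)
  finite := inferInstance
  graph := SimpleGraph.starGraph none
  isTree := SimpleGraph.isTree_starGraph none
  -- A leaf is glued by its point at infinity to its multiple point on the centre; the value at the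
  -- centre with itself is arbitrary. On a leaf, marked points have their indices as affine
  -- coordinates, hence are distinct and away from the node.
  node v w := v.elim (w.elim inftyPt Subtype.val) fun _ => inftyPt
  comp i := if h : ∃ j k, j ≠ k ∧ q j = q i ∧ q k = q i then some ⟨q i, h⟩ else none
  mark i := if ∃ j k, j ≠ k ∧ q j = q i ∧ q k = q i then affinePt (i : ℕ) else q i
  node_inj v w w' hw hw' h := by
    rw [SimpleGraph.starGraph_adj] at hw hw'
    rcases v with _ | v
    · rcases w with _ | w
      · exact absurd rfl hw.1
      rcases w' with _ | w'
      · exact absurd rfl hw'.1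
      exact congrArg some (Subtype.ext h)
    · rw [hw.2.resolve_left (by simp), hw'.2.resolve_left (by simp)]
  mark_inj i j hc hm := by
    split_ifs at hc hm with h1 h2 h2
    · exact Fin.ext (by exact_mod_cast affinePt_injective hm)
    · by_contra hij
      exact h1 ⟨i, j, hij, rfl, hm.symm⟩
  mark_ne_node i w hw hm := by
    rw [SimpleGraph.starGraph_adj] at hw
    split_ifs at hw hm with h1
    · exact affinePt_ne_inftyPt _ hm
    · rcases w with _ | ⟨x, hx⟩
      · exact absurd rfl hw.1
      · change q i = x at hm
        subst hm
        exact h1 hx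
  stable v := by
    rcases v with _ | v
    · refine hq.trans ?_
      have hsub : Set.range q ⊆ (fun v : Option (MultiplePoint q) => v.elim inftyPt Subtype.val) ''
          {w | (SimpleGraph.starGraph none).Adj none w} ∪
          q '' {i | (if h : ∃ j k, j ≠ k ∧ q j = q i ∧ q k = q i then
            (some ⟨q i, h⟩ : Option (MultiplePoint q)) else none) = none} := by
        rintro _ ⟨i, rfl⟩
        by_cases h : ∃ j k, j ≠ k ∧ q j = q i ∧ q k = q i
        · exact Or.inl ⟨some ⟨q i, h⟩, by simp, rfl⟩
        · exact Or.inr ⟨i, dif_neg h, rfl⟩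
      refine (Set.ncard_le_ncard hsub (Set.toFinite _)).trans ((Set.ncard_union_le _ _).trans ?_)
      exact Nat.add_le_add (Set.ncard_image_le (Set.toFinite _))
        (Set.ncard_image_le (Set.toFinite _))
    · have h1 : ({none} : Set (Option (MultiplePoint q))).ncard ≤
          {w | (SimpleGraph.starGraph none).Adj (some v) w}.ncard :=
        Set.ncard_le_ncard (by rintro _ rfl; simp) (Set.toFinite _)
      rw [Set.ncard_singleton] at h1
      refine (show 3 ≤ 1 + 2 from le_rfl).trans (Nat.add_le_add h1 ?_)
      obtain ⟨x, i, j, hij, hi, hj⟩ := v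
      rw [← Set.ncard_pair hij]
      refine Set.ncard_le_ncard ?_ (Set.toFinite _)
      intro m hm
      have hmx : q m = x := by
        rcases hm with rfl | rfl
        exacts [hi, hj]
      have hmul : ∃ j k, j ≠ k ∧ q j = q m ∧ q k = q m :=
        ⟨i, j, hij, hi.trans hmx.symm, hj.trans hmx.symm⟩
      exact (dif_pos hmul).trans (congrArg some (Subtype.ext hmx))

variable {q} (hq : 3 ≤ (Set.range q).ncard)

/-- The central component. -/
noncomputable def starCenter : (starCurve q hq).V := none

/-- The component attached at a multiple point. -/
noncomputable def starLeaf (x : MultiplePoint q) : (starCurve q hq).V := some x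

lemma starLeaf_injective : Function.Injective (starLeaf hq) := Option.some_injective _

lemma starLeaf_ne_starCenter (x : MultiplePoint q) : starLeaf hq x ≠ starCenter hq :=
  Option.some_ne_none x

lemma starCurve_comp_of_multiple {i : Fin n} (h : ∃ j k, j ≠ k ∧ q j = q i ∧ q k = q i) :
    (starCurve q hq).comp i = starLeaf hq ⟨q i, h⟩ := dif_pos h

lemma starCurve_comp_of_not_multiple {i : Fin n} (h : ¬ ∃ j k, j ≠ k ∧ q j = q i ∧ q k = q i) :
    (starCurve q hq).comp i = starCenter hq := dif_neg h

lemma starCurve_proj_center (i : Fin n) : (starCurve q hq).proj (starCenter hq) i = q i := by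
  by_cases h : ∃ j k, j ≠ k ∧ q j = q i ∧ q k = q i
  · have hc := starCurve_comp_of_multiple hq h
    rw [StableCurve.proj_eq_dir _ (by rw [hc]; exact starLeaf_ne_starCenter _ _), hc,
      StableCurve.dir, StableCurve.next_of_adj]
    · rfl
    · exact SimpleGraph.starGraph_center_adj (starLeaf_ne_starCenter hq _).symm
  · rw [← starCurve_comp_of_not_multiple hq h, StableCurve.proj_comp]
    exact if_neg h

lemma starCurve_proj_leaf_of_ne (x : MultiplePoint q) {i : Fin n} (h : q i ≠ x) :
    (starCurve q hq).proj (starLeaf hq x) i = inftyPt := by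
  rw [StableCurve.proj_eq_dir]
  · rfl
  · intro hc
    by_cases hi : ∃ j k, j ≠ k ∧ q j = q i ∧ q k = q i
    · rw [starCurve_comp_of_multiple hq hi] at hc
      exact h (congrArg Subtype.val (starLeaf_injective hq hc))
    · rw [starCurve_comp_of_not_multiple hq hi] at hc
      exact starLeaf_ne_starCenter hq x hc.symm

end Star

/-! ### Every point of the pencil comes from a curve -/

namespace StableCurve

lemma forget_kapranov_eq_mk {C : StableCurve (1 + 4)} (v : C.V) {a : Fin 2 → ℂ} (ha : a ≠ 0)
    (h : a 0 * (bracket (C.proj v 0) (C.proj v 2) * bracket (C.proj v 1) (C.proj v 3)) =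
      a 1 * (bracket (C.proj v 0) (C.proj v 1) * bracket (C.proj v 2) (C.proj v 3)))
    (hne : bracket (C.proj v 0) (C.proj v 2) * bracket (C.proj v 1) (C.proj v 3) ≠ 0 ∨
      bracket (C.proj v 0) (C.proj v 1) * bracket (C.proj v 2) (C.proj v 3) ≠ 0) :
    C.forget.kapranov (k := 1) = Projectivization.mk ℂ a ha := by
  have h1 := C.forget_kapranovVec_mul v
  apply mk_eq_mk_of_cross
  have key : C.forget.kapranovVec (k := 1) 0 * a 1 = C.forget.kapranovVec (k := 1) 1 * a 0 := by
    rcases hne with hne | hne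
    · apply mul_left_cancel₀ hne
      linear_combination a 1 * h1 - C.forget.kapranovVec (k := 1) 1 * h
    · apply mul_left_cancel₀ hne
      linear_combination a 0 * h1 - C.forget.kapranovVec (k := 1) 0 * h
  intro i j
  fin_cases i <;> fin_cases j
  · rfl
  · exact key
  · exact key.symm
  · rfl

end StableCurve

/-- The curves whose central component carries the last marked point. -/
lemma exists_curve_of_ne {a : Fin 2 → ℂ} {b : Fin 3 → ℂ} (ha : a ≠ 0) (hb : b ≠ 0)
    (h : a 0 * b 1 * (b 0 - b 2) = a 1 * b 0 * (b 1 - b 2))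
    (hne : b 1 * (b 0 - b 2) ≠ 0 ∨ b 0 * (b 1 - b 2) ≠ 0) :
    ∃ C : StableCurve 5, C.forget.kapranov (k := 1) = Projectivization.mk ℂ a ha ∧
      C.kapranov (k := 2) = Projectivization.mk ℂ b hb := by
  obtain ⟨c, d, hc, hd, h1, h2, -⟩ := exists_bracket_affinePt
  -- The position forced by `b`. Some of the finite points may coincide, but as `b ≠ 0` at least
  -- three values occur. Infinity occurs once, so the fifth point stays on the centre.
  let q : Fin 5 → P1 := ![affinePt 0, affinePt (b 0), affinePt (b 1), affinePt (b 2), inftyPt]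
  have hq : 3 ≤ (Set.range q).ncard := by
    obtain ⟨j, hj⟩ := Function.ne_iff.1 hb
    have hj' : affinePt 0 ≠ affinePt (b j) := fun h => hj (affinePt_injective h).symm
    fin_cases j
    · exact three_le_ncard_range 0 1 4 hj' (affinePt_ne_inftyPt _) (affinePt_ne_inftyPt _)
    · exact three_le_ncard_range 0 2 4 hj' (affinePt_ne_inftyPt _) (affinePt_ne_inftyPt _)
    · exact three_le_ncard_range 0 3 4 hj' (affinePt_ne_inftyPt _) (affinePt_ne_inftyPt _)
  refine ⟨starCurve q hq, StableCurve.forget_kapranov_eq_mk (starCenter hq) ha ?_ ?_, ?_⟩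
  · simp only [starCurve_proj_center]
    change a 0 * (bracket (affinePt 0) (affinePt (b 1)) * bracket (affinePt (b 0)) (affinePt (b 2))) =
      a 1 * (bracket (affinePt 0) (affinePt (b 0)) * bracket (affinePt (b 1)) (affinePt (b 2)))
    rw [h1, h1, h1, h1]
    linear_combination (-(c 0 * c (b 0) * c (b 1) * c (b 2))) * h
  · simp only [starCurve_proj_center]
    change bracket (affinePt 0) (affinePt (b 1)) * bracket (affinePt (b 0)) (affinePt (b 2)) ≠ 0 ∨
      bracket (affinePt 0) (affinePt (b 0)) * bracket (affinePt (b 1)) (affinePt (b 2)) ≠ 0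
    rw [h1, h1, h1, h1]
    simpa [hc] using hne
  · have hroot : (starCurve q hq).comp 4 = starCenter hq := by
      apply starCurve_comp_of_not_multiple
      have h4 : ∀ i, q i = q 4 → i = 4 := by
        intro i hi
        fin_cases i
        · exact absurd hi (affinePt_ne_inftyPt _)
        · exact absurd hi (affinePt_ne_inftyPt _)
        · exact absurd hi (affinePt_ne_inftyPt _)
        · exact absurd hi (affinePt_ne_inftyPt _)
        · rfl
      rintro ⟨j, k, hjk, hj, hk⟩
      exact hjk ((h4 j hj).trans (h4 k hk).symm)
    -- The scalar `c (b j)` of the representative cancels, leaving a factor independent of `j`.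
    have hvec : ∀ j, (starCurve q hq).kapranovVec (k := 2) j = -(c 0 / d) * b j := by
      intro j
      have : (starCurve q hq).kapranovVec (k := 2) j =
          bracket ((starCurve q hq).proj ((starCurve q hq).comp 4) 0)
            ((starCurve q hq).proj ((starCurve q hq).comp 4) j.succ.castSucc) /
          bracket ((starCurve q hq).proj ((starCurve q hq).comp 4) 4)
            ((starCurve q hq).proj ((starCurve q hq).comp 4) j.succ.castSucc) := rfl
      rw [this, hroot, starCurve_proj_center, starCurve_proj_center, starCurve_proj_center]
      have hqj : q j.succ.castSucc = affinePt (b j) := by fin_cases j <;> rfl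
      have hcj := hc (b j)
      rw [hqj]
      change bracket (affinePt 0) _ / bracket inftyPt _ = _
      rw [h1, h2]
      field_simp
      ring
    apply mk_eq_mk_of_cross
    intro i j
    rw [hvec, hvec]
    ring

/-- The curves on which the component of the last marked point carries two marked points and is
attached to the central component at infinity. -/
lemma exists_curve_of_inftyPt {q : Fin 5 → P1} (l : Fin 4)
    (hl : ∀ i, q i = inftyPt ↔ i = l.castSucc ∨ i = 4) (hq : 3 ≤ (Set.range q).ncard)
    {a : Fin 2 → ℂ} {b : Fin 3 → ℂ} (ha : a ≠ 0) (hb : b ≠ 0)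
    (h : a 0 * (bracket (q 0) (q 2) * bracket (q 1) (q 3)) =
      a 1 * (bracket (q 0) (q 1) * bracket (q 2) (q 3)))
    (hne : bracket (q 0) (q 2) * bracket (q 1) (q 3) ≠ 0 ∨
      bracket (q 0) (q 1) * bracket (q 2) (q 3) ≠ 0)
    (hb₀ : l = 0 → ∀ i j, b i = b j) (hb₁ : l ≠ 0 → ∀ j : Fin 3, j.succ ≠ l → b j = 0) :
    ∃ C : StableCurve 5, C.forget.kapranov (k := 1) = Projectivization.mk ℂ a ha ∧
      C.kapranov (k := 2) = Projectivization.mk ℂ b hb := by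
  refine ⟨starCurve q hq, StableCurve.forget_kapranov_eq_mk (starCenter hq) ha ?_ ?_, ?_⟩
  · simpa only [starCurve_proj_center] using h
  · simpa only [starCurve_proj_center] using hne
  have h4 : q 4 = inftyPt := (hl 4).2 (Or.inr rfl)
  have hmul : ∃ j k, j ≠ k ∧ q j = q 4 ∧ q k = q 4 :=
    ⟨l.castSucc, 4, (Fin.castSucc_lt_last l).ne, by rw [h4, (hl _).2 (Or.inl rfl)], rfl⟩
  have hproj : ∀ i : Fin 4, i ≠ l →
      (starCurve q hq).proj ((starCurve q hq).comp 4) i.castSucc = inftyPt := by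
    intro i hi
    rw [starCurve_comp_of_multiple hq hmul]
    apply starCurve_proj_leaf_of_ne
    change q i.castSucc ≠ q 4
    rw [h4, Ne, hl, not_or]
    exact ⟨fun h => hi (Fin.castSucc_injective _ h), (Fin.castSucc_lt_last i).ne⟩
  have hvec : ∀ j, (starCurve q hq).kapranovVec (k := 2) j =
      bracket ((starCurve q hq).proj ((starCurve q hq).comp 4) 0)
        ((starCurve q hq).proj ((starCurve q hq).comp 4) j.succ.castSucc) /
      bracket ((starCurve q hq).proj ((starCurve q hq).comp 4) 4)
        ((starCurve q hq).proj ((starCurve q hq).comp 4) j.succ.castSucc) := fun j => rfl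
  apply mk_eq_mk_of_cross
  intro i j
  -- On the component of the fifth point, all marked points but `l` and the fifth project to the
  -- node. If `l = 0`, all coordinates agree; otherwise the first point is at the node too, and only
  -- the coordinate belonging to `l` survives.
  by_cases hl0 : l = 0
  · rw [hvec, hvec, hproj i.succ (by rw [hl0]; exact i.succ_ne_zero),
      hproj j.succ (by rw [hl0]; exact j.succ_ne_zero), hb₀ hl0 i j]
  · have hvec0 : ∀ j : Fin 3, j.succ ≠ l → (starCurve q hq).kapranovVec (k := 2) j = 0 := by
      intro j hj
      rw [hvec, hproj j.succ hj]
      have : (starCurve q hq).proj ((starCurve q hq).comp 4) 0 = inftyPt := hproj 0 (Ne.symm hl0)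
      rw [this, bracket_self, zero_div]
    by_cases hi : i.succ = l <;> by_cases hj : j.succ = l
    · rw [Fin.succ_injective _ (hi.trans hj.symm)]
    · rw [hvec0 j hj, hb₁ hl0 j hj, mul_zero, zero_mul]
    · rw [hvec0 i hi, hb₁ hl0 i hi, mul_zero, zero_mul]
    · rw [hvec0 i hi, hvec0 j hj, zero_mul, zero_mul]

/-- The points of `ℙ¹ × ℙ²` over the four base points of the pencil. -/
lemma exists_curve_of_eq {a : Fin 2 → ℂ} {b : Fin 3 → ℂ} (ha : a ≠ 0) (hb : b ≠ 0)
    (h1 : b 1 * (b 0 - b 2) = 0) (h0 : b 0 * (b 1 - b 2) = 0) :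
    ∃ C : StableCurve 5, C.forget.kapranov (k := 1) = Projectivization.mk ℂ a ha ∧
      C.kapranov (k := 2) = Projectivization.mk ℂ b hb := by
  obtain ⟨c, d, hc, hd, hcc, hdc, hcd⟩ := exists_bracket_affinePt
  have hne := affinePt_ne_inftyPt
  have hinj := affinePt_injective
  have ha' : a 0 ≠ 0 ∨ a 1 ≠ 0 := by
    by_contra! h
    apply ha
    ext j
    fin_cases j
    exacts [h.1, h.2]
  have h0a : ∀ j, a j ≠ 0 → affinePt 0 ≠ affinePt (a j) := fun j hj h => hj (hinj h).symm
  -- The four cases are the base points `[0:0:1]`, `[0:1:0]`, `[1:0:0]`, `[1:1:1]`, with `l = 3, 2,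
  -- 1, 0`. The three marked points other than `l` and the fifth are placed at `0`, `a 0`, `a 1`, in
  -- the order that makes the cross-ratio `[a]`; they do not all coincide, as `a ≠ 0`.
  by_cases hb0 : b 0 = 0
  · rw [hb0, zero_sub, mul_neg, neg_eq_zero, mul_eq_zero] at h1
    rcases h1 with hb1 | hb2
    · refine exists_curve_of_inftyPt (q := ![affinePt 0, affinePt (a 0), affinePt (a 1), inftyPt,
        inftyPt]) 3 (fun i => by fin_cases i <;> simp [hne]) ?_ ha hb ?_ ?_ (by simp) ?_
      · rcases ha' with ha' | ha'
        · exact three_le_ncard_range 0 1 4 (h0a _ ha') (hne _) (hne _)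
        · exact three_le_ncard_range 0 2 4 (h0a _ ha') (hne _) (hne _)
      · simp [hcc, hcd]
        ring
      · simpa [hcc, hcd, hc, hd] using ha'.symm
      · intro _ j hj
        fin_cases j
        exacts [hb0, hb1, absurd rfl hj]
    · refine exists_curve_of_inftyPt (q := ![affinePt (a 0), affinePt 0, inftyPt, affinePt (a 1),
        inftyPt]) 2 (fun i => by fin_cases i <;> simp [hne]) ?_ ha hb ?_ ?_ (by simp) ?_
      · rcases ha' with ha' | ha'
        · exact three_le_ncard_range 1 0 4 (h0a _ ha') (hne _) (hne _)
        · exact three_le_ncard_range 1 3 4 (h0a _ ha') (hne _) (hne _)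
      · simp [hcc, hcd, hdc]
        ring
      · simpa [hcc, hcd, hdc, hc, hd] using ha'.symm
      · intro _ j hj
        fin_cases j
        exacts [hb0, absurd rfl hj, hb2]
  · have hb12 := sub_eq_zero.1 ((mul_eq_zero.1 h0).resolve_left hb0)
    rcases mul_eq_zero.1 h1 with hb1 | hb02
    · refine exists_curve_of_inftyPt (q := ![affinePt (a 1), inftyPt, affinePt 0, affinePt (a 0),
        inftyPt]) 1 (fun i => by fin_cases i <;> simp [hne]) ?_ ha hb ?_ ?_ (by simp) ?_
      · rcases ha' with ha' | ha'
        · exact three_le_ncard_range 2 3 4 (h0a _ ha') (hne _) (hne _)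
        · exact three_le_ncard_range 2 0 4 (h0a _ ha') (hne _) (hne _)
      · simp [hcc, hcd, hdc]
        ring
      · simpa [hcc, hcd, hdc, hc, hd] using ha'.symm
      · intro _ j hj
        fin_cases j
        exacts [absurd rfl hj, hb1, hb12.symm.trans hb1]
    · have hb02 := sub_eq_zero.1 hb02
      refine exists_curve_of_inftyPt (q := ![inftyPt, affinePt (a 1), affinePt (a 0), affinePt 0,
        inftyPt]) 0 (fun i => by fin_cases i <;> simp [hne]) ?_ ha hb ?_ ?_ ?_ (by simp)
      · rcases ha' with ha' | ha'
        · exact three_le_ncard_range 3 2 4 (h0a _ ha') (hne _) (hne _)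
        · exact three_le_ncard_range 3 1 4 (h0a _ ha') (hne _) (hne _)
      · simp [hcc, hdc]
        ring
      · simpa [hcc, hdc, hc, hd] using ha'.symm
      · have : ∀ i, b i = b 2 := by
          intro i
          fin_cases i
          exacts [hb02, hb12, rfl]
        intro _ i j
        rw [this i, this j]

/-- Necessity is `equation_kapranovVec`, rescaled in bidegree `(1, 2)`. For sufficiency, `b` is a
base point exactly when both coefficients of `a` vanish, and each case has its own curve. -/
theorem mem_range_phi_iff {a : Fin 2 → ℂ} {b : Fin 3 → ℂ} (ha : a ≠ 0) (hb : b ≠ 0) :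
    (Projectivization.mk ℂ a ha, Projectivization.mk ℂ b hb) ∈ Set.range phi ↔
      a 0 * b 1 * (b 0 - b 2) = a 1 * b 0 * (b 1 - b 2) := by
  constructor
  · rintro ⟨x, hx⟩
    induction x using Quotient.inductionOn with | _ C
    have h1 : C.forget.kapranov (k := 1) = Projectivization.mk ℂ a ha := congrArg Prod.fst hx
    have h2 : C.kapranov (k := 2) = Projectivization.mk ℂ b hb := congrArg Prod.snd hx
    obtain ⟨s, hs⟩ := (Projectivization.mk_eq_mk_iff' ℂ _ _ _ _).1 h1.symm
    obtain ⟨t, ht⟩ := (Projectivization.mk_eq_mk_iff' ℂ _ _ _ _).1 h2.symm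
    rw [← hs, ← ht]
    simp only [Pi.smul_apply, smul_eq_mul]
    linear_combination s * t ^ 2 * C.equation_kapranovVec
  · intro h
    have : ∃ C : StableCurve 5, C.forget.kapranov (k := 1) = Projectivization.mk ℂ a ha ∧
        C.kapranov (k := 2) = Projectivization.mk ℂ b hb := by
      by_cases h1 : b 1 * (b 0 - b 2) = 0
      · by_cases h0 : b 0 * (b 1 - b 2) = 0
        · exact exists_curve_of_eq ha hb h1 h0
        · exact exists_curve_of_ne ha hb h (Or.inr h0)
      · exact exists_curve_of_ne ha hb h (Or.inl h1)
    obtain ⟨C, h1, h2⟩ := this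
    exact ⟨Quotient.mk _ C, Prod.ext h1 h2⟩

/-! ### The ideal of the image -/

section Ideal

open MvPolynomial

/-- An endomorphism which kills `p` and is the identity modulo `p` has the kernel `(p)`. -/
lemma dvd_iff_algHom_eq_zero {σ R : Type*} [CommRing R] {p : MvPolynomial σ R}
    (φ : MvPolynomial σ R →ₐ[R] MvPolynomial σ R) (hp : φ p = 0) (h : ∀ i, p ∣ X i - φ (X i))
    (F : MvPolynomial σ R) : p ∣ F ↔ φ F = 0 := by
  have key : p ∣ F - φ F := by
    induction F using MvPolynomial.induction_on with
    | C a => simp [MvPolynomial.algHom_C]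
    | add F G hF hG =>
      rw [map_add, add_sub_add_comm]
      exact dvd_add hF hG
    | mul_X F i hF =>
      have : F * X i - φ (F * X i) = (F - φ F) * X i + φ F * (X i - φ (X i)) := by
        rw [map_mul]
        ring
      rw [this]
      exact dvd_add (hF.mul_right _) ((h i).mul_left _)
  constructor
  · rintro ⟨G, rfl⟩
    rw [map_mul, hp, zero_mul]
  · intro hF
    rwa [hF, sub_zero] at key

/-- The ideal `(p)` is the kernel of a map to a domain, hence prime, and `E` lies outside it. The
cofactor of `E` is therefore divisible by `p`, which cancels. -/
lemma dvd_of_dvd_mul_of_algHom {σ R : Type*} [CommRing R] [IsDomain R] {p E F : MvPolynomial σ R}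
    (hp0 : p ≠ 0) (φ : MvPolynomial σ R →ₐ[R] MvPolynomial σ R) (hp : φ p = 0)
    (h : ∀ i, p ∣ X i - φ (X i)) (hE : φ E ≠ 0) (hdvd : E ∣ p * F) : E ∣ F := by
  obtain ⟨G, hG⟩ := hdvd
  have h1 : φ G = 0 := by
    have h2 := congrArg φ hG
    rw [map_mul, map_mul, hp, zero_mul, eq_comm, mul_eq_zero] at h2
    exact h2.resolve_left hE
  obtain ⟨G', rfl⟩ := (dvd_iff_algHom_eq_zero φ hp h G).2 h1
  exact ⟨G', mul_left_cancel₀ hp0 (by rw [hG]; ring)⟩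

/-- Setting `b₁ = 0` turns `equation` into `a₁ b₀ b₂`, which is not zero. -/
lemma equation_dvd_of_dvd_X_mul {F : Cox} (h : equation ∣ X (.inr 1) * F) : equation ∣ F := by
  let f : Fin 2 ⊕ Fin 3 → Cox := fun i => if i = .inr 1 then 0 else X i
  refine dvd_of_dvd_mul_of_algHom (X_ne_zero _) (aeval f) ?_ ?_ ?_ h
  · simp [f]
  · intro i
    by_cases hi : i = .inr 1
    · simp [f, hi]
    · simp [f, hi]
  · intro h0
    have := congrArg (eval (fun _ => (1 : ℂ))) h0
    simp [equation, f] at this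

/-- Setting `b₀ = b₂` turns `equation` into `-a₁ b₂ (b₁ - b₂)`, which is not zero. -/
lemma equation_dvd_of_dvd_X_sub_X_mul {F : Cox}
    (h : equation ∣ (X (.inr 0) - X (.inr 2)) * F) : equation ∣ F := by
  let f : Fin 2 ⊕ Fin 3 → Cox := fun i => if i = .inr 0 then X (.inr 2) else X i
  refine dvd_of_dvd_mul_of_algHom ?_ (aeval f) ?_ ?_ ?_ h
  · rw [sub_ne_zero]
    exact fun h' => by simpa using X_injective h'
  · simp [f]
  · intro i
    by_cases hi : i = .inr 0
    · simp [f, hi]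
    · simp [f, hi]
  · intro h0
    have := congrArg (eval (Sum.elim (fun _ => 1) ![0, 2, 1] : Fin 2 ⊕ Fin 3 → ℂ)) h0
    simp [equation, f] at this
    norm_num at this

/-- Homogeneity in the `a`-variables with a polynomial scaling factor, which replaces division by
`b₁(b₀ - b₂)`. -/
lemma aeval_mul_of_isWeightedHomogeneous {F : Cox} {d : ℕ × ℕ}
    (hF : IsWeightedHomogeneous bidegree F d) (c : Cox) (u : Fin 2 → Cox) (w : Fin 3 → Cox) :
    aeval (Sum.elim (fun i => c * u i) w) F = c ^ d.1 * aeval (Sum.elim u w) F := by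
  rw [F.as_sum, map_sum, map_sum, Finset.mul_sum]
  refine Finset.sum_congr rfl fun m hm => ?_
  have h := congrArg Prod.fst (hF (mem_support_iff.1 hm))
  rw [Finsupp.weight_apply, Finsupp.sum_fintype _ _ (by simp), Fintype.sum_sum_type] at h
  simp only [bidegree, Sum.elim_inl, Sum.elim_inr, Prod.fst_add, Prod.fst_sum, Prod.smul_fst,
    smul_eq_mul, mul_one, mul_zero, Finset.sum_const_zero, add_zero] at h
  rw [aeval_monomial, aeval_monomial, Finsupp.prod_fintype _ _ (by simp),
    Finsupp.prod_fintype _ _ (by simp), Fintype.prod_sum_type, Fintype.prod_sum_type]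
  simp only [Sum.elim_inl, Sum.elim_inr, mul_pow, Finset.prod_mul_distrib, ← h,
    Finset.prod_pow_eq_pow_sum]
  ring

lemma isBihomogeneous_equation : IsBihomogeneous equation := by
  have ha : ∀ i, IsWeightedHomogeneous (R := ℂ) bidegree (X (.inl i)) (1, 0) := fun i =>
    isWeightedHomogeneous_X ℂ bidegree (.inl i)
  have hb : ∀ i, IsWeightedHomogeneous (R := ℂ) bidegree (X (.inr i)) (0, 1) := fun i =>
    isWeightedHomogeneous_X ℂ bidegree (.inr i)
  refine ⟨(1, 2), ?_⟩
  have hs : ∀ F G : Cox, IsWeightedHomogeneous bidegree F (1, 2) →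
      IsWeightedHomogeneous bidegree G (1, 2) → IsWeightedHomogeneous bidegree (F - G) (1, 2) :=
    fun F G hF hG => Submodule.sub_mem (weightedHomogeneousSubmodule ℂ bidegree (1, 2)) hF hG
  have hs' : ∀ F G : Cox, IsWeightedHomogeneous bidegree F (0, 1) →
      IsWeightedHomogeneous bidegree G (0, 1) → IsWeightedHomogeneous bidegree (F - G) (0, 1) :=
    fun F G hF hG => Submodule.sub_mem (weightedHomogeneousSubmodule ℂ bidegree (0, 1)) hF hG
  exact hs _ _ (((ha 0).mul (hb 1)).mul (hs' _ _ (hb 0) (hb 2)))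
    (((ha 1).mul (hb 0)).mul (hs' _ _ (hb 1) (hb 2)))

lemma eval_equation (a : Fin 2 → ℂ) (b : Fin 3 → ℂ) : eval (Sum.elim a b) equation =
    a 0 * b 1 * (b 0 - b 2) - a 1 * b 0 * (b 1 - b 2) := by
  simp [equation]

/-- The polynomials of `ℂ[b₀, b₁, b₂]` by which the pencil is parametrized. -/
noncomputable def pencilParam : Fin 2 → Cox :=
  ![X (.inr 0) * (X (.inr 1) - X (.inr 2)), X (.inr 1) * (X (.inr 0) - X (.inr 2))]

/-- Where `pencilParam 1` is nonzero, the parametrized point is a genuine point of the image, so `F`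
vanishes there. Multiplying by `pencilParam 1` takes care of all other points, and a polynomial that
vanishes everywhere on `ℂ⁵` is zero. -/
lemma aeval_pencilParam_eq_zero {F : Cox} (hF : ∀ x ∈ Set.range phi, VanishesAt F x) :
    aeval (Sum.elim pencilParam fun i => X (.inr i)) F = 0 := by
  have hw : pencilParam 1 ≠ 0 := by
    intro h0
    have := congrArg (eval (Sum.elim 0 ![0, 1, 1] : Fin 2 ⊕ Fin 3 → ℂ)) h0
    simp [pencilParam] at this
  apply (mul_eq_zero.1 (?_ : pencilParam 1 * _ = 0)).resolve_left hw
  apply MvPolynomial.funext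
  intro x
  rw [map_mul, map_zero]
  by_cases hx : eval x (pencilParam 1) = 0
  · rw [hx, zero_mul]
  have hcomp : eval x (aeval (Sum.elim pencilParam fun i => X (.inr i)) F) =
      eval (Sum.elim (fun i => eval x (pencilParam i)) fun i => x (.inr i)) F := by
    rw [← coe_aeval_eq_eval, ← coe_aeval_eq_eval]
    refine (comp_aeval_apply _ (aeval x) F).trans ?_
    have hf : (fun i => aeval x ((Sum.elim pencilParam fun i => X (.inr i)) i)) =
        Sum.elim (fun i => eval x (pencilParam i)) fun i => x (.inr i) := by
      ext1 i
      rcases i with i | i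
      · rfl
      · exact aeval_X _ _
    rw [hf]
    rfl
  rw [hcomp]
  have ha : (fun i => eval x (pencilParam i)) ≠ 0 := fun h => hx (congrFun h 1)
  have hb : (fun i => x (.inr i)) ≠ (0 : Fin 3 → ℂ) := by
    intro h
    have h1 : x (.inr 1) = 0 := congrFun h 1
    apply hx
    simp [pencilParam, h1]
  rw [hF _ ((mem_range_phi_iff ha hb).2 ?_) _ _ ha hb rfl rfl, mul_zero]
  simp [pencilParam]
  ring

/-- Write `w = b₁(b₀ - b₂)`. Modulo `equation`, the vector `w · a` is `a₁ · pencilParam`. Hence `w ^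
d.1 * F` is congruent to `a₁ ^ d.1` times the substitution of `pencilParam` into `F`, which is zero;
the factors of `w` are then cancelled. -/
lemma equation_dvd {F : Cox} (hF : IsBihomogeneous F) (hX : ∀ x ∈ Set.range phi, VanishesAt F x) :
    equation ∣ F := by
  obtain ⟨d, hd⟩ := hF
  have h1 : equation ∣ pencilParam 1 ^ d.1 * F := by
    let a : Fin 2 → Cox := fun i => X (.inl i)
    let b : Fin 3 → Cox := fun i => X (.inr i)
    have h2 : pencilParam 1 ^ d.1 * F = aeval (Sum.elim (fun i => pencilParam 1 * a i) b) F := by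
      rw [aeval_mul_of_isWeightedHomogeneous hd]
      congr 1
      have : (Sum.elim a b) = X := by
        ext1 i
        rcases i with i | i <;> rfl
      rw [this, aeval_X_left_apply]
    have h3 : aeval (Sum.elim (fun i => a 1 * pencilParam i) b) F = 0 := by
      rw [aeval_mul_of_isWeightedHomogeneous hd, aeval_pencilParam_eq_zero hX, mul_zero]
    rw [h2, ← sub_zero (aeval _ F), ← h3, ← Ideal.mem_span_singleton, ← Ideal.Quotient.eq]
    have h4 : ∀ f : Fin 2 ⊕ Fin 3 → Cox, Ideal.Quotient.mk (Ideal.span {equation}) (aeval f F) =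
        aeval (fun i => Ideal.Quotient.mk (Ideal.span {equation}) (f i)) F := fun f =>
      comp_aeval_apply f (Ideal.Quotient.mkₐ ℂ (Ideal.span {equation})) F
    rw [h4, h4]
    congr 2
    ext1 i
    rcases i with i | i
    · rw [Ideal.Quotient.eq, Ideal.mem_span_singleton]
      fin_cases i
      · refine ⟨1, ?_⟩
        simp [a, pencilParam, equation]
        ring
      · refine ⟨0, ?_⟩
        simp [a]
        ring
    · rfl
  have h2 : ∀ (m : ℕ) (F : Cox), equation ∣ pencilParam 1 ^ m * F → equation ∣ F := by
    intro m
    induction m with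
    | zero => simp
    | succ m ih =>
      intro F h
      apply ih
      apply equation_dvd_of_dvd_X_sub_X_mul
      apply equation_dvd_of_dvd_X_mul
      convert h using 1
      simp [pencilParam]
      ring
  exact h2 _ _ h1

theorem vanishingIdeal_range_phi : vanishingIdeal (Set.range phi) = Ideal.span {equation} := by
  apply le_antisymm
  · rw [vanishingIdeal, Ideal.span_le]
    rintro F ⟨hF, hX⟩
    exact Ideal.mem_span_singleton.2 (equation_dvd hF hX)
  · rw [Ideal.span_singleton_le_iff_mem]
    refine Ideal.subset_span ⟨isBihomogeneous_equation, ?_⟩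
    rintro ⟨_, _⟩ hx a b ha hb rfl rfl
    rw [eval_equation, (mem_range_phi_iff ha hb).1 hx, sub_self]

end Ideal

/-! ### The pencil of conics -/

section Conic

open MvPolynomial

lemma eval_conic (a : Fin 2 → ℂ) (b : Fin 3 → ℂ) : eval b (conic a) =
    a 0 * b 1 * (b 0 - b 2) - a 1 * b 0 * (b 1 - b 2) := by
  simp [conic]

lemma conic_mem (a : Fin 2 → ℂ) : conic a ∈ quadricsThroughFourPoints := by
  refine ⟨?_, ?_, ?_, ?_, ?_⟩
  · have hX : ∀ i : Fin 3, (X i : MvPolynomial (Fin 3) ℂ).IsHomogeneous 1 := isHomogeneous_X ℂ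
    exact ((((isHomogeneous_C _ (a 0)).mul (hX 1)).mul ((hX 0).sub (hX 2))).sub
      (((isHomogeneous_C _ (a 1)).mul (hX 0)).mul ((hX 1).sub (hX 2))))
  all_goals
    rw [eval_conic]
    simp

lemma conic_injective : Function.Injective conic := by
  intro a a' h
  -- At these two points the conic takes the values `-a 0` and `a 1`.
  have h0 := congrArg (eval ![0, 1, 1]) h
  have h1 := congrArg (eval ![1, 0, 1]) h
  rw [eval_conic, eval_conic] at h0 h1
  ext j
  fin_cases j
  · simpa using h0
  · simpa using h1

/-- A quadratic form in three variables, in terms of its coefficients. -/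
lemma eval_of_isHomogeneous_two {Q : MvPolynomial (Fin 3) ℂ} (hQ : Q.IsHomogeneous 2) :
    ∃ c : Fin 3 → Fin 3 → ℂ, ∀ b, eval b Q = ∑ i, ∑ j, c i j * (b i * b j) := by
  have hlin : ∀ F ∈ homogeneousSubmodule (Fin 3) ℂ 1, ∃ c : Fin 3 → ℂ, ∀ b,
      eval b F = ∑ i, c i * b i := by
    intro F hF
    rw [homogeneousSubmodule_one_eq_span_X, Submodule.mem_span_range_iff_exists_fun] at hF
    obtain ⟨c, rfl⟩ := hF
    exact ⟨c, fun b => by simp [smul_eval]⟩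
  have hQ' : Q ∈ homogeneousSubmodule (Fin 3) ℂ 1 * homogeneousSubmodule (Fin 3) ℂ 1 := by
    rw [← pow_two, homogeneousSubmodule_one_pow]
    exact hQ
  clear hQ
  induction hQ' using Submodule.mul_induction_on' with
  | mem_mul_mem F hF G hG =>
    obtain ⟨c, hc⟩ := hlin F hF
    obtain ⟨d, hd⟩ := hlin G hG
    refine ⟨fun i j => c i * d j, fun b => ?_⟩
    rw [map_mul, hc, hd, Finset.sum_mul_sum]
    exact Finset.sum_congr rfl fun i _ => Finset.sum_congr rfl fun j _ => by ring
  | add F _ G _ hF hG =>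
    obtain ⟨c, hc⟩ := hF
    obtain ⟨d, hd⟩ := hG
    refine ⟨c + d, fun b => ?_⟩
    rw [map_add, hc, hd]
    simp only [Pi.add_apply, add_mul, Finset.sum_add_distrib]

theorem bijOn_conic : Set.BijOn conic Set.univ quadricsThroughFourPoints := by
  refine ⟨fun a _ => conic_mem a, conic_injective.injOn, ?_⟩
  rintro Q ⟨hQ, h1, h2, h3, h4⟩
  obtain ⟨c, hc⟩ := eval_of_isHomogeneous_two hQ
  rw [hc] at h1 h2 h3 h4
  simp [Fin.sum_univ_three] at h1 h2 h3 h4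
  -- Vanishing at the coordinate points removes the squares. In `conic a` the coefficients of
  -- `b₁b₂`, `b₀b₂`, `b₀b₁` are `-a 0`, `a 1`, `a 0 - a 1`. The first two give the witness; the
  -- third follows from vanishing at `[1:1:1]`.
  refine ⟨![-(c 1 2 + c 2 1), c 0 2 + c 2 0], Set.mem_univ _, MvPolynomial.funext fun b => ?_⟩
  rw [eval_conic, hc]
  simp [Fin.sum_univ_three, h1, h2, h3]
  rw [h1, h2, h3] at h4
  linear_combination (-b 0 * b 1) * h4

end Conic
end PointedCurves

theorem mainTheorem4 :
    PointedCurves.vanishingIdeal (Set.range PointedCurves.phi) =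
        Ideal.span {PointedCurves.equation} ∧
      Function.Injective PointedCurves.phi ∧
      (∀ (a : Fin 2 → ℂ) (b : Fin 3 → ℂ) (ha : a ≠ 0) (hb : b ≠ 0),
        (Projectivization.mk ℂ a ha, Projectivization.mk ℂ b hb) ∈
            Set.range PointedCurves.phi ↔
          MvPolynomial.eval b (PointedCurves.conic a) = 0) ∧
      Set.BijOn PointedCurves.conic Set.univ PointedCurves.quadricsThroughFourPoints := by
  refine ⟨PointedCurves.vanishingIdeal_range_phi, PointedCurves.phi_injective,
    fun a b ha hb => ?_, PointedCurves.bijOn_conic⟩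
  rw [PointedCurves.mem_range_phi_iff, PointedCurves.eval_conic, sub_eq_zero]
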